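/- **Model.** The input is a simple graph $G$ with vertex set $[1..n]$ and $m\ge 1$ edges, each edge $e$ having a real weight $w(e)>0$. There are $m$ stations with IDs $1,\dots,m$; each edge is held by exactly one station and each station holds exactly one edge. A station initially knows $n$, its ID, its edge and the weight of its edge, but not $m$. The stations communicate in synchronous steps over a multiple-access channel with collision detection: in each step all stations hear silence if no station transmits, the transmitted message if exactly one station transmits, and a collision noise (distinct from silence) if at least two stations transmit. A randomized algorithm proceeds by queries. Each query is determined by $n$ and the feedback heard in the preceding steps; it specifies which stations are to attempt a transmission in the step (in terms of their IDs, edges and weights) and a probability. Each specified station transmits with this probability, independently over stations and steps; its message is a dummy message, its weight, its edge, or its edge with the weight. Whether the algorithm halts, and what it then outputs, is likewise determined by $n$ and the feedback heard. The time of an execution is the number of steps performed until the algorithm halts. A spanning forest of $G$ is a maximal cycle-free set $T$ of edges of $G$, and $|T|$ is its number of edges. An algorithm finds a minimum-weight spanning forest if in every possible execution its output is a spanning forest of $G$ of the smallest total weight, all of whose edges have been heard on the channel during the execution. **Theorem.** There is a randomized algorithm such that, for all $n$ and all $m\ge 1$ and every weighted graph with $n$ vertices and $m$ edges distributed among $m$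 stations as above, the algorithm finds a minimum-weight spanning forest $T$ in expected time $\mathcal{O}(|T|+W\log m)$, where $W$ is the number of distinct weights on the edges of $T$, and in worst-case time $\mathcal{O}(m)$. The constants hidden in the $\mathcal{O}$ notation are absolute. -/

import Mathlib

open scoped ENNReal NNReal

/-! ## Minimum-weight spanning forests -/

/-- `F` is the edge set of a (maximal) spanning forest of `G`: a cycle-free set of edges of `G`
to which no further edge of `G` can be added without creating a cycle. -/
def IsSpanningForest {n : ℕ} (G : SimpleGraph (Fin n)) (F : Finset (Sym2 (Fin n))) : Prop :=
  (∀ e ∈ F, e ∈ G.edgeSet) ∧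
  (SimpleGraph.fromEdgeSet (F : Set (Sym2 (Fin n)))).IsAcyclic ∧
  ∀ e ∈ G.edgeSet, e ∉ F →
    ¬ (SimpleGraph.fromEdgeSet (insert e (F : Set (Sym2 (Fin n))))).IsAcyclic

/-- A spanning forest whose total weight is smallest among all spanning forests of `G`. -/
def IsMinWeightSpanningForest {n : ℕ} (G : SimpleGraph (Fin n)) (w : Sym2 (Fin n) → ℝ)
    (F : Finset (Sym2 (Fin n))) : Prop :=
  IsSpanningForest G F ∧
  ∀ F' : Finset (Sym2 (Fin n)), IsSpanningForest G F' → ∑ e ∈ F, w e ≤ ∑ e ∈ F', w e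

/-- The number of distinct weights on the edges of `F`. -/
noncomputable def numWeights {n : ℕ} (w : Sym2 (Fin n) → ℝ) (F : Finset (Sym2 (Fin n))) : ℕ :=
  (F.image w).card

namespace Channel

/-! ## The multiple-access channel with collision detection -/

/-- What a transmitting station puts into its message: nothing (a dummy message), the weight of
its edge, its edge, or its edge together with the weight. -/
inductive Content
  | dummy
  | weight
  | edge
  | edgeAndWeight

/-- Messages, for input graphs with `n` vertices. -/
inductive Message (n : ℕ)
  | dummy
  | weight (x : ℝ)
  | edge (e : Sym2 (Fin n))
  | edgeAndWeight (e : Sym2 (Fin n)) (x : ℝ)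

/-- The message with content of kind `c` of a station that holds the edge `e` of weight `x`. -/
def Content.message {n : ℕ} (c : Content) (e : Sym2 (Fin n)) (x : ℝ) : Message n :=
  match c with
  | .dummy => .dummy
  | .weight => .weight x
  | .edge => .edge e
  | .edgeAndWeight => .edgeAndWeight e x

/-- The message reveals the edge `e`. -/
def Message.Reveals {n : ℕ} (msg : Message n) (e : Sym2 (Fin n)) : Prop :=
  match msg with
  | .dummy => False
  | .weight _ => False
  | .edge e' => e' = e
  | .edgeAndWeight e' _ => e' = e

/-- What all the stations hear on the channel in one step: background noise (no station
transmitted), collision noise (at least two stations transmitted), or the message of the only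
station that transmitted. -/
inductive Feedback (n : ℕ)
  | silence
  | collision
  | heard (msg : Message n)

/-- The feedback of the steps performed so far, in chronological order. -/
abbrev History (n : ℕ) := List (Feedback n)

/-- The edge `e` has been heard on the channel. -/
def History.Reveals {n : ℕ} (h : History n) (e : Sym2 (Fin n)) : Prop :=
  ∃ msg : Message n, Feedback.heard msg ∈ h ∧ msg.Reveals e

/-- One query of a randomized algorithm. `specified p e x` says that the station with ID `p`, if
it holds the edge `e` of weight `x`, is specified by the query; each specified station performs
a random experiment with probability of success `prob`, the same for all the stations, and
transmits a message with the given kind of content if the experiment succeeds. -/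
structure Query (n : ℕ) where
  specified : ℕ → Sym2 (Fin n) → ℝ → Prop
  prob : ℝ≥0
  prob_le_one : prob ≤ 1
  content : Content

/-- A randomized adaptive algorithm. The next query is determined by the number `n` of vertices
and by the feedback heard so far (in particular the number of edges is not known);
`query n h = none` means that the algorithm halts. `output n h` is the set of edges it returns
when it halts after having heard `h`. -/
structure Algorithm where
  query : (n : ℕ) → History n → Option (Query n)
  output : (n : ℕ) → History n → Finset (Sym2 (Fin n))

/-- A weighted graph distributed among stations: a simple graph on `n` vertices with positive
weights on its edges, and `m` stations that hold its edges, each edge being held by exactly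
one station and each station holding exactly one edge.
The weights of pairs that are not edges play no role. -/
structure Input (n m : ℕ) where
  graph : SimpleGraph (Fin n)
  weight : Sym2 (Fin n) → ℝ
  weight_pos : ∀ e ∈ graph.edgeSet, 0 < weight e
  holds : Fin m ≃ graph.edgeSet

/-- The edge held by the station `i`. -/
def Input.edge {n m : ℕ} (inp : Input n m) (i : Fin m) : Sym2 (Fin n) :=
  (inp.holds i : Sym2 (Fin n))

open Classical in
/-- The stations specified by a query. The IDs of the `m` stations are `1, …, m`, so the station
with index `i : Fin m` has the ID `i + 1`. -/
noncomputable def Input.specified {n m : ℕ} (inp : Input n m) (q : Query n) : Finset (Fin m) :=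
  Finset.univ.filter fun i => q.specified ((i : ℕ) + 1) (inp.edge i) (inp.weight (inp.edge i))

/-- The random subset of `S` that contains each element of `S` with probability `p`,
independently of the other elements. -/
noncomputable def randomSubset {m : ℕ} (S : Finset (Fin m)) (p : ℝ≥0) (hp : p ≤ 1) :
    PMF (Finset (Fin m)) :=
  PMF.ofFinset
    (fun A => if A ⊆ S then ((p ^ A.card * (1 - p) ^ (S.card - A.card) : ℝ≥0) : ℝ≥0∞) else 0)
    S.powerset
    (by
      rw [Finset.sum_congr rfl fun A hA => if_pos (Finset.mem_powerset.mp hA),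
        ← ENNReal.ofNNReal_finsetSum, Finset.sum_pow_mul_eq_add_pow, add_tsub_cancel_of_le hp]
      simp)
    (fun A hA => if_neg fun h => hA (Finset.mem_powerset.mpr h))

/-- What is heard when exactly the stations in `A` transmit. -/
noncomputable def Input.feedback {n m : ℕ} (inp : Input n m) (c : Content)
    (A : Finset (Fin m)) : Feedback n :=
  match A.toList with
  | [] => .silence
  | [i] => .heard (c.message (inp.edge i) (inp.weight (inp.edge i)))
  | _ => .collision

/-! ## Executions and their running time -/

/-- The algorithm performs another step after having heard `h`. -/
def Algorithm.Running (alg : Algorithm) {n : ℕ} (h : History n) : Prop :=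
  alg.query n h ≠ none

/-- One step of the execution after the history `h`. The random experiments are independent of
everything before; if the algorithm has halted then the history does not change any more. -/
noncomputable def Algorithm.step (alg : Algorithm) {n m : ℕ} (inp : Input n m)
    (h : History n) : PMF (History n) :=
  match alg.query n h with
  | none => PMF.pure h
  | some q =>
      (randomSubset (inp.specified q) q.prob q.prob_le_one).map
        fun A => h ++ [inp.feedback q.content A]

/-- The distribution of the history after `t` time units; it consists of the feedback of the
first `t` steps, or of all the steps if the algorithm halted earlier. -/
noncomputable def Algorithm.historyAt (alg : Algorithm) {n m : ℕ} (inp : Input n m) :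
    ℕ → PMF (History n)
  | 0 => PMF.pure []
  | t + 1 => (alg.historyAt inp t).bind (alg.step inp)

/-- The expected number of steps that are performed: the sum over `t` of the probability that
the step number `t + 1` is performed. -/
noncomputable def Algorithm.expectedTime (alg : Algorithm) {n m : ℕ} (inp : Input n m) : ℝ≥0∞ :=
  ∑' t : ℕ, (alg.historyAt inp t).toOuterMeasure {h | alg.Running h}

/-- In every possible execution at most `N` steps are performed. -/
def Algorithm.HaltsWithin (alg : Algorithm) {n m : ℕ} (inp : Input n m) (N : ℕ) : Prop :=
  ∀ h ∈ (alg.historyAt inp N).support, ¬ alg.Running h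

/-- In every possible execution, when the algorithm halts, its output is a minimum-weight
spanning forest all edges of which have been heard on the channel. -/
def Algorithm.FindsMinWeightSpanningForest (alg : Algorithm) {n m : ℕ} (inp : Input n m) : Prop :=
  ∀ t : ℕ, ∀ h ∈ (alg.historyAt inp t).support, ¬ alg.Running h →
    IsMinWeightSpanningForest inp.graph inp.weight (alg.output n h) ∧
    ∀ e ∈ alg.output n h, h.Reveals e

end Channel

/-!
The algorithm is a randomized version of Kruskal's algorithm. To find the smallest weight of an edge
that joins two trees of the current forest, all stations that hold such an edge compete for the
channel; whenever one is heard, only the stations with strictly smaller weights stay in the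
competition. The station heard is uniformly distributed among the competitors, so with probability
at least `1 / 2` the number of competitors is halved, and `O(log m)` of them have to be heard for
each weight. Then all the edges of this weight that still join different trees are collected, each
of them at constant expected cost.

Competing stations transmit with probability `2⁻ᵏ`, where `k` is increased after a collision and
decreased after silence. If `2ᵏ` is far from the number of competitors, this moves `k` in the right
direction with high probability; otherwise a station is heard with probability bounded from below.
Hence a potential that combines `k`, the number of competitors, and the edges and weights missing
from the forest decreases by at least one per step in expectation. Its initial value, and hence the
expected number of steps, is `O(|T| + W log m)`, because the forest is always a subset of a
minimum-weight spanning forest, and any two such forests have the same weights.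

The steps of this search alternate with those of a scan that hears the stations one after the other
in the order of their IDs, which bounds the worst-case time by `O(m)`.
-/

/-! ## Greedy forests -/

section EdgeSpan

variable {V : Type*}

/-- The pairs of vertices that are connected by edges in `F`: the closure of `F` in the graphic
matroid. It contains all the diagonal pairs. -/
def edgeSpan (F : Set (Sym2 V)) : Set (Sym2 V) :=
  Sym2.fromRel (r := (SimpleGraph.fromEdgeSet F).Reachable) ⟨fun _ _ => SimpleGraph.Reachable.symm⟩

theorem mk_mem_edgeSpan {F : Set (Sym2 V)} {u v : V} :
    s(u, v) ∈ edgeSpan F ↔ (SimpleGraph.fromEdgeSet F).Reachable u v :=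
  Sym2.fromRel_prop

theorem edgeSpan_empty : edgeSpan (∅ : Set (Sym2 V)) = Sym2.diagSet := by
  ext e
  induction e with | _ u v => simp [mk_mem_edgeSpan]

theorem subset_edgeSpan (F : Set (Sym2 V)) : F ⊆ edgeSpan F := by
  intro e he
  induction e with | _ u v => ?_
  rw [mk_mem_edgeSpan]
  by_cases huv : u = v
  · rw [huv]
  · exact SimpleGraph.Adj.reachable ((SimpleGraph.fromEdgeSet_adj F).mpr ⟨he, huv⟩)

theorem edgeSpan_subset_of_subset_edgeSpan {F K : Set (Sym2 V)} (h : F ⊆ edgeSpan K) :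
    edgeSpan F ⊆ edgeSpan K := by
  intro e he
  induction e with | _ u v => ?_
  rw [mk_mem_edgeSpan] at he ⊢
  obtain ⟨p⟩ := he
  induction p with
  | nil => rfl
  | cons hadj _ ih =>
    exact (mk_mem_edgeSpan.mp (h ((SimpleGraph.fromEdgeSet_adj F).mp hadj).1)).trans ih

theorem edgeSpan_mono : Monotone (edgeSpan : Set (Sym2 V) → Set (Sym2 V)) :=
  fun _ K h => edgeSpan_subset_of_subset_edgeSpan (h.trans (subset_edgeSpan K))

theorem not_isDiag_of_notMem_edgeSpan {F : Set (Sym2 V)} {e : Sym2 V} (he : e ∉ edgeSpan F) :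
    ¬ e.IsDiag :=
  fun hd => he (edgeSpan_mono (Set.empty_subset F) (edgeSpan_empty.symm ▸ hd))

theorem isAcyclic_fromEdgeSet_insert_iff {F : Set (Sym2 V)} {e : Sym2 V} (hd : ¬ e.IsDiag)
    (he : e ∉ F) :
    (SimpleGraph.fromEdgeSet (insert e F)).IsAcyclic ↔
      (SimpleGraph.fromEdgeSet F).IsAcyclic ∧ e ∉ edgeSpan F := by
  induction e with | _ u v => ?_
  have huv : u ≠ v := by simpa using hd
  have hsup : SimpleGraph.fromEdgeSet (insert s(u, v) F) =
      SimpleGraph.fromEdgeSet F ⊔ SimpleGraph.edge u v := by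
    rw [SimpleGraph.edge, ← SimpleGraph.fromEdgeSet_union, Set.union_singleton]
  rw [hsup, SimpleGraph.isAcyclic_sup_fromEdgeSet_iff, mk_mem_edgeSpan]
  simp [huv, he]

-- Exchange argument: an edge of `K` outside `F` can be replaced by an edge of `F`.
theorem card_le_card_of_subset_edgeSpan {F K : Finset (Sym2 V)} (hd : ∀ e ∈ K, ¬ e.IsDiag)
    (hK : (SimpleGraph.fromEdgeSet (K : Set (Sym2 V))).IsAcyclic)
    (h : (K : Set (Sym2 V)) ⊆ edgeSpan F) : K.card ≤ F.card := by
  classical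
  induction hr : (K \ F).card generalizing K with
  | zero => exact Finset.card_le_card (by simpa using hr)
  | succ r ih =>
    obtain ⟨e, he⟩ : (K \ F).Nonempty := Finset.card_pos.mp (by omega)
    have heK := (Finset.mem_sdiff.mp he).1
    have hcoe : (K : Set (Sym2 V)) = insert e ↑(K.erase e) := by
      rw [← Finset.coe_insert, Finset.insert_erase heK]
    obtain ⟨hacyclic, hespan⟩ :=
      (isAcyclic_fromEdgeSet_insert_iff (hd e heK) (by simp)).mp (hcoe ▸ hK)
    obtain ⟨f, hfF, hfspan⟩ : ∃ f ∈ F, f ∉ edgeSpan (K.erase e : Set (Sym2 V)) := by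
      by_contra! hF
      exact hespan (edgeSpan_subset_of_subset_edgeSpan hF (h heK))
    have hfK : f ∉ K.erase e := fun hf => hfspan (subset_edgeSpan _ hf)
    have hfd := not_isDiag_of_notMem_edgeSpan hfspan
    calc K.card = (insert f (K.erase e)).card := by
          rw [Finset.card_insert_of_notMem hfK, Finset.card_erase_add_one heK]
      _ ≤ F.card := ih
          (Finset.forall_mem_insert .. |>.mpr
            ⟨hfd, fun g hg => hd g (Finset.mem_of_mem_erase hg)⟩)
          (by
            rw [Finset.coe_insert, isAcyclic_fromEdgeSet_insert_iff hfd (by exact_mod_cast hfK)]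
            exact ⟨hacyclic, hfspan⟩)
          (by
            rw [Finset.coe_insert, Set.insert_subset_iff]
            exact ⟨subset_edgeSpan _ hfF, (by simp : _ ⊆ (K : Set (Sym2 V))).trans h⟩)
          (by
            rw [Finset.insert_sdiff_of_mem _ hfF, Finset.erase_sdiff_comm,
              Finset.card_erase_of_mem he, hr, Nat.add_sub_cancel])

end EdgeSpan

section Matching

variable {α β M : Type*} [LinearOrder M] {w : α → M} {w' : β → M} {F : Finset α} {F' : Finset β}

theorem exists_injective_le_of_card_filter_le
    (h : ∀ t, (F'.filter fun e => w' e ≤ t).card ≤ (F.filter fun e => w e ≤ t).card) :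
    ∃ σ : F' → F, Function.Injective σ ∧ ∀ e, w (σ e) ≤ w' e := by
  classical
  have hall : ∀ S : Finset F', S.card ≤ (S.biUnion fun e => F.filter fun f => w f ≤ w' e).card := by
    intro S
    rcases S.eq_empty_or_nonempty with rfl | hS
    · simp
    obtain ⟨top, htop, hle⟩ := S.exists_max_image (fun e => w' e) hS
    calc S.card = (S.map (Function.Embedding.subtype _)).card := (Finset.card_map _).symm
      _ ≤ (F'.filter fun e => w' e ≤ w' top).card := Finset.card_le_card fun e he => by
          obtain ⟨e, heS, rfl⟩ := Finset.mem_map.mp he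
          exact Finset.mem_filter.mpr ⟨e.2, hle e heS⟩
      _ ≤ (F.filter fun f => w f ≤ w' top).card := h _
      _ ≤ _ := Finset.card_le_card
          (Finset.subset_biUnion_of_mem (fun e : F' => F.filter fun f => w f ≤ w' e) htop)
  obtain ⟨σ, hinj, hσ⟩ := (Finset.all_card_le_biUnion_card_iff_exists_injective _).mp hall
  simp only [Finset.mem_filter] at hσ
  exact ⟨fun e => ⟨σ e, (hσ e).1⟩, fun a b hab => hinj (congrArg Subtype.val hab),
    fun e => (hσ e).2⟩

end Matching

section GreedyForest

variable {V α : Type*} [LinearOrder α] {G : SimpleGraph V} {w : Sym2 V → α}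
  {F K : Finset (Sym2 V)}

/-- The possible intermediate results of Kruskal's algorithm: every edge of `G` that is spanned
by `F` is spanned already by the edges of `F` that are not heavier, and the other edges of `G` are
at least as heavy as all the edges of `F`. -/
structure IsGreedyForest (G : SimpleGraph V) (w : Sym2 V → α) (F : Finset (Sym2 V)) : Prop where
  subset_edgeSet : (F : Set (Sym2 V)) ⊆ G.edgeSet
  isAcyclic : (SimpleGraph.fromEdgeSet (F : Set (Sym2 V))).IsAcyclic
  mem_edgeSpan_le : ∀ e ∈ G.edgeSet, e ∈ edgeSpan (F : Set (Sym2 V)) →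
    e ∈ edgeSpan {f | f ∈ F ∧ w f ≤ w e}
  le_of_notMem_edgeSpan : ∀ e ∈ G.edgeSet, e ∉ edgeSpan (F : Set (Sym2 V)) → ∀ f ∈ F, w f ≤ w e

theorem isGreedyForest_empty : IsGreedyForest G w ∅ where
  subset_edgeSet := by simp
  isAcyclic := by simp
  mem_edgeSpan_le e he hspan := by
    rw [Finset.coe_empty, edgeSpan_empty] at hspan
    exact absurd hspan (G.not_isDiag_of_mem_edgeSet he)
  le_of_notMem_edgeSpan := by simp

theorem IsGreedyForest.insert_min [DecidableEq V] (hF : IsGreedyForest G w F) {e : Sym2 V}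
    (he : e ∈ G.edgeSet) (hspan : e ∉ edgeSpan (F : Set (Sym2 V)))
    (hmin : ∀ e' ∈ G.edgeSet, e' ∉ edgeSpan (F : Set (Sym2 V)) → w e ≤ w e') :
    IsGreedyForest G w (insert e F) := by
  have hle : ∀ e' ∈ G.edgeSet, e' ∉ edgeSpan (F : Set (Sym2 V)) →
      ∀ f ∈ insert e F, w f ≤ w e' := fun e' he' hspan' =>
    Finset.forall_mem_insert .. |>.mpr
      ⟨hmin e' he' hspan', hF.le_of_notMem_edgeSpan e' he' hspan'⟩
  refine ⟨?_, ?_, fun e' he' hspan' => ?_, fun e' he' hspan' => ?_⟩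
  · rw [Finset.coe_insert]
    exact Set.insert_subset he hF.subset_edgeSet
  · rw [Finset.coe_insert, isAcyclic_fromEdgeSet_insert_iff (G.not_isDiag_of_mem_edgeSet he)
      fun heF => hspan (subset_edgeSpan _ heF)]
    exact ⟨hF.isAcyclic, hspan⟩
  · by_cases hold : e' ∈ edgeSpan (F : Set (Sym2 V))
    · exact edgeSpan_mono
        (Set.ofPred_subset_ofPred.mpr fun f hf => ⟨Finset.mem_insert_of_mem hf.1, hf.2⟩)
        (hF.mem_edgeSpan_le e' he' hold)
    · exact edgeSpan_mono (Set.subset_ofPred.mpr fun f hf => ⟨hf, hle e' he' hold f hf⟩) hspan'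
  · exact hle e' he' fun hold => hspan' (edgeSpan_mono (by simp) hold)

theorem IsGreedyForest.exists_superset_spanning [Finite V] (hF : IsGreedyForest G w F) :
    ∃ F', F ⊆ F' ∧ IsGreedyForest G w F' ∧ G.edgeSet ⊆ edgeSpan (F' : Set (Sym2 V)) := by
  classical
  obtain ⟨F', hFF', hmax⟩ := (Set.toFinite {F' | IsGreedyForest G w F'}).exists_le_maximal hF
  refine ⟨F', hFF', hmax.prop, fun e he => ?_⟩
  by_contra hspan
  obtain ⟨e₀, ⟨he₀, hspan₀⟩, hmin⟩ := Set.exists_min_image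
    (G.edgeSet \ edgeSpan (F' : Set (Sym2 V))) w (Set.toFinite _) ⟨e, he, hspan⟩
  have hins := hmax.prop.insert_min he₀ hspan₀ fun e' he' hspan' => hmin e' ⟨he', hspan'⟩
  exact hspan₀ (subset_edgeSpan _ (hmax.le_of_ge hins (Finset.subset_insert e₀ F')
    (Finset.mem_insert_self e₀ F')))

theorem IsGreedyForest.card_filter_le (hF : IsGreedyForest G w F)
    (hspan : G.edgeSet ⊆ edgeSpan (F : Set (Sym2 V))) (hKG : (K : Set (Sym2 V)) ⊆ G.edgeSet)
    (hK : (SimpleGraph.fromEdgeSet (K : Set (Sym2 V))).IsAcyclic) (t : α) :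
    (K.filter fun e => w e ≤ t).card ≤ (F.filter fun e => w e ≤ t).card := by
  have hsub : ((K.filter fun e => w e ≤ t : Finset _) : Set (Sym2 V)) ⊆ K := by
    exact_mod_cast Finset.filter_subset _ K
  refine card_le_card_of_subset_edgeSpan
    (fun e he => G.not_isDiag_of_mem_edgeSet (hKG (hsub he)))
    (hK.anti (SimpleGraph.fromEdgeSet_mono hsub)) fun e he => ?_
  have heG := hKG (hsub he)
  exact edgeSpan_mono
    (fun f hf => Finset.mem_filter.mpr ⟨hf.1, hf.2.trans (Finset.mem_filter.mp he).2⟩)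
    (hF.mem_edgeSpan_le e heG (hspan heG))

end GreedyForest

section MinWeight

variable {n : ℕ} {G : SimpleGraph (Fin n)} {w : Sym2 (Fin n) → ℝ} {F T : Finset (Sym2 (Fin n))}

theorem IsSpanningForest.edgeSet_subset_edgeSpan (hT : IsSpanningForest G T) :
    G.edgeSet ⊆ edgeSpan (T : Set (Sym2 (Fin n))) := by
  intro e he
  by_cases heT : e ∈ T
  · exact subset_edgeSpan _ heT
  · by_contra hspan
    exact hT.2.2 e he heT ((isAcyclic_fromEdgeSet_insert_iff (G.not_isDiag_of_mem_edgeSet he)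
      (by exact_mod_cast heT)).mpr ⟨hT.2.1, hspan⟩)

theorem IsSpanningForest.card_le (hF : IsSpanningForest G F) (hT : IsSpanningForest G T) :
    F.card ≤ T.card :=
  card_le_card_of_subset_edgeSpan (fun e he => G.not_isDiag_of_mem_edgeSet (hF.1 e he)) hF.2.1
    fun e he => hT.edgeSet_subset_edgeSpan (hF.1 e he)

theorem IsGreedyForest.isSpanningForest (hF : IsGreedyForest G w F)
    (hspan : G.edgeSet ⊆ edgeSpan (F : Set (Sym2 (Fin n)))) : IsSpanningForest G F := by
  refine ⟨hF.subset_edgeSet, hF.isAcyclic, fun e he heF hins => ?_⟩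
  rw [isAcyclic_fromEdgeSet_insert_iff (G.not_isDiag_of_mem_edgeSet he) heF] at hins
  exact hins.2 (hspan he)

theorem IsGreedyForest.exists_equiv_le (hF : IsGreedyForest G w F)
    (hspan : G.edgeSet ⊆ edgeSpan (F : Set (Sym2 (Fin n)))) (hT : IsSpanningForest G T) :
    ∃ σ : T ≃ F, ∀ e, w (σ e) ≤ w e := by
  obtain ⟨σ, hinj, hσ⟩ :=
    exists_injective_le_of_card_filter_le (hF.card_filter_le hspan hT.1 hT.2.1)
  have hbij := hinj.bijective_of_nat_card_le
    (by simpa using (hF.isSpanningForest hspan).card_le hT)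
  exact ⟨Equiv.ofBijective σ hbij, hσ⟩

theorem IsGreedyForest.isMinWeightSpanningForest (hF : IsGreedyForest G w F)
    (hspan : G.edgeSet ⊆ edgeSpan (F : Set (Sym2 (Fin n)))) :
    IsMinWeightSpanningForest G w F := by
  refine ⟨hF.isSpanningForest hspan, fun T hT => ?_⟩
  obtain ⟨σ, hσ⟩ := hF.exists_equiv_le hspan hT
  calc ∑ e ∈ F, w e = ∑ e : T, w (σ e) := by
        rw [← Finset.sum_coe_sort F w, Equiv.sum_comp σ fun e : F => w e]
    _ ≤ ∑ e : T, w e := Finset.sum_le_sum fun e _ => hσ e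
    _ = ∑ e ∈ T, w e := Finset.sum_coe_sort T w

theorem IsGreedyForest.card_le (hF : IsGreedyForest G w F) (hT : IsSpanningForest G T) :
    F.card ≤ T.card := by
  obtain ⟨F', hFF', hF', hspan⟩ := hF.exists_superset_spanning
  exact (Finset.card_le_card hFF').trans ((hF'.isSpanningForest hspan).card_le hT)

theorem IsGreedyForest.image_weight_subset (hF : IsGreedyForest G w F)
    (hT : IsMinWeightSpanningForest G w T) : F.image w ⊆ T.image w := by
  obtain ⟨F', hFF', hF', hspan⟩ := hF.exists_superset_spanning
  obtain ⟨σ, hσ⟩ := hF'.exists_equiv_le hspan hT.1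
  have hsum : ∑ e : T, w (σ e) = ∑ e : T, w e := by
    refine (Finset.sum_le_sum fun e _ => hσ e).antisymm ?_
    rw [Equiv.sum_comp σ fun e : F' => w e, Finset.sum_coe_sort T w, Finset.sum_coe_sort F' w]
    exact hT.2 F' (hF'.isSpanningForest hspan)
  have hσ_eq := (Finset.sum_eq_sum_iff_of_le fun e _ => hσ e).mp hsum
  rw [Finset.image_subset_iff]
  intro f hf
  have heq := hσ_eq (σ.symm ⟨f, hFF' hf⟩) (Finset.mem_univ _)
  rw [Equiv.apply_symm_apply] at heq
  exact heq ▸ Finset.mem_image_of_mem w (σ.symm _).2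

variable (G w) in
theorem exists_isMinWeightSpanningForest : ∃ F, IsMinWeightSpanningForest G w F := by
  obtain ⟨F, -, hF, hspan⟩ := (isGreedyForest_empty (G := G) (w := w)).exists_superset_spanning
  exact ⟨F, hF.isMinWeightSpanningForest hspan⟩

theorem IsMinWeightSpanningForest.congr_weight {w' : Sym2 (Fin n) → ℝ}
    (hF : IsMinWeightSpanningForest G w F) (h : Set.EqOn w w' G.edgeSet) :
    IsMinWeightSpanningForest G w' F := by
  refine ⟨hF.1, fun T hT => ?_⟩
  rw [← Finset.sum_congr rfl fun e he => h (hF.1.1 e he),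
    ← Finset.sum_congr rfl fun e he => h (hT.1 e he)]
  exact hF.2 T hT

theorem IsSpanningForest.nonempty (hT : IsSpanningForest G T) (hG : G.edgeSet.Nonempty) :
    T.Nonempty := by
  rw [Finset.nonempty_iff_ne_empty]
  rintro rfl
  obtain ⟨e, he⟩ := hG
  have hspan := hT.edgeSet_subset_edgeSpan he
  rw [Finset.coe_empty, edgeSpan_empty] at hspan
  exact G.not_isDiag_of_mem_edgeSet he hspan

end MinWeight

namespace Channel

/-! ## Expected time and drift -/

section Expectation

variable {α β : Type*}

/-- The expected value of `f` under the distribution `p`. -/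
noncomputable def expectation (p : PMF α) (f : α → ℝ≥0∞) : ℝ≥0∞ :=
  ∑' a, p a * f a

theorem expectation_pure (a : α) (f : α → ℝ≥0∞) : expectation (PMF.pure a) f = f a := by
  rw [expectation, tsum_eq_single a fun b hb => by rw [PMF.pure_apply_of_ne _ _ hb, zero_mul],
    PMF.pure_apply_self, one_mul]

theorem expectation_bind (p : PMF α) (q : α → PMF β) (f : β → ℝ≥0∞) :
    expectation (p.bind q) f = expectation p fun a => expectation (q a) f := by
  simp_rw [expectation, PMF.bind_apply, ← ENNReal.tsum_mul_right, ← ENNReal.tsum_mul_left,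
    mul_assoc]
  exact ENNReal.tsum_comm

theorem expectation_map (p : PMF α) (g : α → β) (f : β → ℝ≥0∞) :
    expectation (p.map g) f = expectation p fun a => f (g a) := by
  simp_rw [← PMF.bind_pure_comp, expectation_bind, Function.comp_apply, expectation_pure]

theorem expectation_mono {p : PMF α} {f g : α → ℝ≥0∞} (h : ∀ a ∈ p.support, f a ≤ g a) :
    expectation p f ≤ expectation p g := by
  refine ENNReal.tsum_le_tsum fun a => ?_
  by_cases ha : a ∈ p.support
  · gcongr
    exact h a ha
  · simp [(p.apply_eq_zero_iff a).mpr ha]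

theorem expectation_add (p : PMF α) (f g : α → ℝ≥0∞) :
    expectation p (fun a => f a + g a) = expectation p f + expectation p g := by
  simp_rw [expectation, mul_add, ENNReal.tsum_add]

theorem expectation_const_mul (p : PMF α) (c : ℝ≥0∞) (f : α → ℝ≥0∞) :
    expectation p (fun a => c * f a) = c * expectation p f := by
  simp_rw [expectation, mul_left_comm _ c, ENNReal.tsum_mul_left]

theorem expectation_const (p : PMF α) (c : ℝ≥0∞) : expectation p (fun _ => c) = c := by
  rw [expectation, ENNReal.tsum_mul_right, p.tsum_coe, one_mul]

theorem expectation_indicator_one (p : PMF α) (s : Set α) :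
    expectation p (s.indicator 1) = p.toOuterMeasure s := by
  rw [PMF.toOuterMeasure_apply, expectation]
  refine tsum_congr fun a => ?_
  by_cases ha : a ∈ s <;> simp [ha]

end Expectation

namespace Algorithm

variable {alg : Algorithm} {n m : ℕ} {inp : Input n m}

theorem step_of_not_running {h : History n} (hh : ¬ alg.Running h) :
    alg.step inp h = PMF.pure h := by
  simp [Algorithm.step, not_not.mp hh]

theorem step_of_query_eq_some {h : History n} {q : Query n} (hq : alg.query n h = some q) :
    alg.step inp h = (randomSubset (inp.specified q) q.prob q.prob_le_one).map
      fun A => h ++ [inp.feedback q.content A] := by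
  simp [Algorithm.step, hq]

theorem forall_mem_support_historyAt {I : ℕ → History n → Prop} (hnil : I 0 [])
    (hstep : ∀ t h, I t h → ∀ h' ∈ (alg.step inp h).support, I (t + 1) h') (t : ℕ) :
    ∀ h ∈ (alg.historyAt inp t).support, I t h := by
  induction t with
  | zero => simpa [Algorithm.historyAt] using hnil
  | succ t ih =>
    intro h hh
    obtain ⟨g, hg, hgh⟩ := (PMF.mem_support_bind_iff _ _ _).mp hh
    exact hstep t g (ih g hg) h hgh

theorem length_eq_of_running {t : ℕ} {h : History n} (hh : h ∈ (alg.historyAt inp t).support)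
    (hrun : alg.Running h) : h.length = t := by
  refine forall_mem_support_historyAt (I := fun t h => alg.Running h → h.length = t)
    (fun _ => rfl) (fun t h ih h' hh' hrun' => ?_) t h hh hrun
  by_cases hrun : alg.Running h
  · obtain ⟨q, hq⟩ := Option.ne_none_iff_exists'.mp hrun
    rw [step_of_query_eq_some hq, PMF.mem_support_map_iff] at hh'
    obtain ⟨A, -, rfl⟩ := hh'
    simp [ih hrun]
  · rw [step_of_not_running hrun, PMF.mem_support_pure_iff] at hh'
    exact absurd (hh' ▸ hrun') hrun

theorem expectation_historyAt_succ_add_le {Φ : History n → ℝ≥0∞} {t : ℕ}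
    (hdrift : ∀ h ∈ (alg.historyAt inp t).support, alg.Running h →
      expectation (alg.step inp h) Φ + 1 ≤ Φ h) :
    expectation (alg.historyAt inp (t + 1)) Φ +
        (alg.historyAt inp t).toOuterMeasure {h | alg.Running h} ≤
      expectation (alg.historyAt inp t) Φ := by
  rw [Algorithm.historyAt, expectation_bind, ← expectation_indicator_one, ← expectation_add]
  refine expectation_mono fun h hh => ?_
  by_cases hrun : alg.Running h
  · simpa [hrun] using hdrift h hh hrun
  · simp [hrun, step_of_not_running hrun, expectation_pure]

theorem expectedTime_le_of_drift {Φ : History n → ℝ≥0∞}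
    (hdrift : ∀ t, ∀ h ∈ (alg.historyAt inp t).support, alg.Running h →
      expectation (alg.step inp h) Φ + 1 ≤ Φ h) :
    alg.expectedTime inp ≤ Φ [] := by
  have htelescope : ∀ N, expectation (alg.historyAt inp N) Φ +
      ∑ t ∈ Finset.range N, (alg.historyAt inp t).toOuterMeasure {h | alg.Running h} ≤ Φ [] := by
    intro N
    induction N with
    | zero => simp [Algorithm.historyAt, expectation_pure]
    | succ N ih =>
      rw [Finset.sum_range_succ, add_comm (∑ t ∈ Finset.range N, _), ← add_assoc]
      exact (add_le_add_left (expectation_historyAt_succ_add_le (hdrift N)) _).trans ih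
  exact ENNReal.tsum_le_of_sum_range_le fun N => le_add_self.trans (htelescope N)

end Algorithm

/-! ## Resolution of contention -/

section TransmissionProb

/-- The probability that none of `s` stations transmits if each one does with probability `p`. -/
noncomputable def silenceProb (p : ℝ) (s : ℕ) : ℝ := (1 - p) ^ s

/-- The probability that exactly one of `s` stations transmits if each one does with
probability `p`. -/
noncomputable def successProb (p : ℝ) (s : ℕ) : ℝ := s * (p * (1 - p) ^ (s - 1))

/-- The probability that at least two of `s` stations transmit if each one does with
probability `p`. -/
noncomputable def collisionProb (p : ℝ) (s : ℕ) : ℝ := 1 - silenceProb p s - successProb p s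

variable {p : ℝ} {s : ℕ}

theorem silenceProb_nonneg (hp1 : p ≤ 1) : 0 ≤ silenceProb p s :=
  pow_nonneg (sub_nonneg.mpr hp1) s

theorem successProb_nonneg (hp0 : 0 ≤ p) (hp1 : p ≤ 1) : 0 ≤ successProb p s :=
  mul_nonneg s.cast_nonneg (mul_nonneg hp0 (pow_nonneg (sub_nonneg.mpr hp1) _))

theorem one_sub_mul_le_silenceProb (hp1 : p ≤ 1) : 1 - s * p ≤ silenceProb p s := by
  have hbernoulli := one_add_mul_le_pow (a := -p) (by linarith) s
  rwa [mul_neg, ← sub_eq_add_neg, ← sub_eq_add_neg] at hbernoulli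

theorem silenceProb_mul_one_add_le_one (hp0 : 0 ≤ p) (hp1 : p ≤ 1) :
    silenceProb p s * (1 + s * p) ≤ 1 :=
  calc silenceProb p s * (1 + s * p) ≤ (1 - p) ^ s * (1 + p) ^ s :=
        mul_le_mul_of_nonneg_left (one_add_mul_le_pow (by linarith) s) (silenceProb_nonneg hp1)
    _ = (1 - p ^ 2) ^ s := by rw [← mul_pow]; ring
    _ ≤ 1 := pow_le_one₀ (by nlinarith) (by nlinarith)

theorem mul_silenceProb_le_successProb (hp0 : 0 ≤ p) (hp1 : p ≤ 1) :
    s * p * silenceProb p s ≤ successProb p s := by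
  rw [successProb, silenceProb, mul_assoc]
  gcongr _ * (_ * ?_)
  exact pow_le_pow_of_le_one (by linarith) (by linarith) (Nat.sub_le s 1)

theorem silenceProb_add_successProb_le_one (hp0 : 0 ≤ p) (hp1 : p ≤ 1) :
    silenceProb p s + successProb p s ≤ 1 := by
  cases s with
  | zero => simp [silenceProb, successProb]
  | succ s =>
    have hle := silenceProb_mul_one_add_le_one (s := s) hp0 hp1
    calc silenceProb p (s + 1) + successProb p (s + 1)
        = silenceProb p s * (1 + s * p) := by
          simp only [silenceProb, successProb, Nat.add_sub_cancel, pow_succ, Nat.cast_succ]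
          ring
      _ ≤ 1 := hle

theorem collisionProb_nonneg (hp0 : 0 ≤ p) (hp1 : p ≤ 1) : 0 ≤ collisionProb p s := by
  have := silenceProb_add_successProb_le_one (s := s) hp0 hp1
  rw [collisionProb]
  linarith

-- By Bernoulli's inequality `(1 - p) ^ (1 / (2 * p)) ≥ 1 / 2`, and `s ≤ 8 * (1 / (2 * p))`.
theorem one_div_le_silenceProb (hp0 : 0 < p) (hp : p ≤ 1 / 2) (hs : s * p ≤ 4) :
    1 / 256 ≤ silenceProb p s := by
  have hbernoulli : 1 / 2 ≤ (1 - p) ^ (1 / (2 * p)) := by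
    have h := one_add_mul_self_le_rpow_one_add (s := -p) (p := 1 / (2 * p)) (by linarith)
      ((one_le_div (by positivity)).mpr (by linarith))
    rw [← sub_eq_add_neg] at h
    refine le_trans (le_of_eq ?_) h
    field_simp
    norm_num
  have hs' : (s : ℝ) ≤ 1 / (2 * p) * (8 : ℕ) := by
    rw [div_mul_eq_mul_div, le_div_iff₀ (by positivity)]
    push_cast
    linarith
  calc (1 : ℝ) / 256 = (1 / 2) ^ 8 := by norm_num
    _ ≤ ((1 - p) ^ (1 / (2 * p))) ^ 8 := by gcongr
    _ = (1 - p) ^ (1 / (2 * p) * (8 : ℕ)) := (Real.rpow_mul_natCast (by linarith) _ 8).symm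
    _ ≤ (1 - p) ^ (s : ℝ) := Real.rpow_le_rpow_of_exponent_ge (by linarith) (by linarith) hs'
    _ = silenceProb p s := Real.rpow_natCast _ s

theorem sum_powerset_pow_mul_le {α : Type*} (S : Finset α) (hp0 : 0 ≤ p) (hp1 : p ≤ 1)
    {f : Finset α → ℝ} {b c : ℝ} (hsingleton : ∑ i ∈ S, f {i} ≤ S.card * b)
    (hlarge : ∀ A, 2 ≤ A.card → f A ≤ c) :
    ∑ A ∈ S.powerset, p ^ A.card * (1 - p) ^ (S.card - A.card) * f A ≤
      silenceProb p S.card * f ∅ + successProb p S.card * b + collisionProb p S.card * c := by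
  classical
  set μ : Finset α → ℝ := fun A => p ^ A.card * (1 - p) ^ (S.card - A.card) with hμ
  have hμ_nonneg : ∀ A, 0 ≤ μ A := fun A =>
    mul_nonneg (pow_nonneg hp0 _) (pow_nonneg (sub_nonneg.mpr hp1) _)
  have htotal : ∑ A ∈ S.powerset, μ A = 1 := by
    rw [hμ, Finset.sum_pow_mul_eq_add_pow, add_sub_cancel, one_pow]
  have hsmall : silenceProb p S.card * (c - f ∅) + p * (1 - p) ^ (S.card - 1) *
      ∑ i ∈ S, (c - f {i}) = ∑ A ∈ insert ∅ (S.image fun i => {i}), μ A * (c - f A) := by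
    rw [Finset.sum_insert (by simp), Finset.sum_image (by simp), Finset.mul_sum]
    simp [hμ, silenceProb]
  have hle : ∑ A ∈ insert ∅ (S.image fun i => {i}), μ A * (c - f A) ≤
      ∑ A ∈ S.powerset, μ A * (c - f A) := by
    refine Finset.sum_le_sum_of_subset_of_nonneg (fun A hA => ?_) fun A hA hA' => ?_
    · simp only [Finset.mem_insert, Finset.mem_image] at hA
      rcases hA with rfl | ⟨i, hi, rfl⟩ <;> simp [*]
    · refine mul_nonneg (hμ_nonneg A) (sub_nonneg.mpr (hlarge A ?_))
      by_contra! hcard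
      rcases A.eq_empty_or_nonempty with rfl | hne
      · simp at hA'
      · obtain ⟨i, rfl⟩ := Finset.card_eq_one.mp
          (le_antisymm (Nat.le_of_lt_succ hcard) hne.card_pos)
        simp_all
  have hsucc : p * (1 - p) ^ (S.card - 1) * ∑ i ∈ S, f {i} ≤ successProb p S.card * b :=
    calc _ ≤ p * (1 - p) ^ (S.card - 1) * (S.card * b) :=
          mul_le_mul_of_nonneg_left hsingleton
            (mul_nonneg hp0 (pow_nonneg (sub_nonneg.mpr hp1) _))
      _ = _ := by rw [successProb]; ring
  simp only [mul_sub, Finset.sum_sub_distrib, ← Finset.sum_mul, htotal, Finset.sum_const,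
    nsmul_eq_mul] at hsmall hle
  rw [collisionProb, successProb]
  rw [successProb] at hsucc
  linarith

end TransmissionProb

section RandomSubset

variable {m : ℕ} {S A : Finset (Fin m)} {p : ℝ≥0} {hp : p ≤ 1}

theorem randomSubset_apply : randomSubset S p hp A =
    if A ⊆ S then ((p ^ A.card * (1 - p) ^ (S.card - A.card) : ℝ≥0) : ℝ≥0∞) else 0 := rfl

theorem subset_of_mem_support_randomSubset (hA : A ∈ (randomSubset S p hp).support) : A ⊆ S := by
  by_contra h
  rw [PMF.mem_support_iff, randomSubset_apply, if_neg h] at hA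
  exact hA rfl

theorem randomSubset_one (h1 : (1 : ℝ≥0) ≤ 1) : randomSubset S 1 h1 = PMF.pure S := by
  ext A
  rw [randomSubset_apply, PMF.pure_apply]
  by_cases hA : A = S
  · simp [hA]
  · rw [if_neg hA, ite_eq_right_iff]
    intro hAS
    have hcard := Finset.card_lt_card (hAS.ssubset_of_ne hA)
    simp [Nat.sub_ne_zero_of_lt hcard]

theorem expectation_randomSubset (f : Finset (Fin m) → ℕ) :
    expectation (randomSubset S p hp) (fun A => (f A : ℝ≥0∞)) = ENNReal.ofReal
      (∑ A ∈ S.powerset, (p : ℝ) ^ A.card * (1 - (p : ℝ)) ^ (S.card - A.card) * f A) := by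
  rw [expectation, tsum_eq_sum (s := S.powerset) fun A hA => by
      rw [randomSubset_apply, if_neg fun h => hA (Finset.mem_powerset.mpr h), zero_mul],
    ENNReal.ofReal_sum_of_nonneg fun A _ => by
      have : (p : ℝ) ≤ 1 := by exact_mod_cast hp
      have := sub_nonneg.mpr this
      positivity]
  refine Finset.sum_congr rfl fun A hA => ?_
  rw [randomSubset_apply, if_pos (Finset.mem_powerset.mp hA), ENNReal.ofReal_mul' (by positivity),
    ENNReal.ofReal_natCast, ← ENNReal.ofReal_coe_nnreal, NNReal.coe_mul, NNReal.coe_pow,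
    NNReal.coe_pow, NNReal.coe_sub hp, NNReal.coe_one]

theorem expectation_randomSubset_le (f : Finset (Fin m) → ℕ) {a b c : ℝ} (hempty : f ∅ ≤ a)
    (hsingleton : ∑ i ∈ S, (f {i} : ℝ) ≤ S.card * b) (hlarge : ∀ A, 2 ≤ A.card → f A ≤ c) :
    expectation (randomSubset S p hp) (fun A => (f A : ℝ≥0∞)) ≤ ENNReal.ofReal
      (silenceProb p S.card * a + successProb p S.card * b + collisionProb p S.card * c) := by
  rw [expectation_randomSubset]
  refine ENNReal.ofReal_le_ofReal
    ((sum_powerset_pow_mul_le S p.coe_nonneg (by exact_mod_cast hp) hsingleton hlarge).trans ?_)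
  gcongr
  exact silenceProb_nonneg (by exact_mod_cast hp)

end RandomSubset

section Contention

/-- The amount by which the potential has to drop when a station is heard, in order to compensate
for the other steps. It is `3 * 512`, where `1 / 512` is the lower bound for the probability that a
station is heard if the transmission probability fits the number of stations. -/
def successGain : ℕ := 1536

/-- The part of the potential that measures how far the transmission probability `2⁻ᵏ` is from
being appropriate for `s` stations. -/
def guessCost (s k : ℕ) : ℕ := 2 * k + 4 * (Nat.size s - k)

theorem guessCost_mono {s s' : ℕ} (h : s ≤ s') (k : ℕ) : guessCost s k ≤ guessCost s' k := by
  have := Nat.size_le_size h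
  unfold guessCost
  omega

theorem guessCost_zero_right (s : ℕ) : guessCost s 0 = 4 * Nat.size s := by
  simp [guessCost]

theorem guessCost_succ_le (s k : ℕ) : guessCost s (k + 1) ≤ guessCost s k + 2 := by
  unfold guessCost
  omega

theorem guessCost_succ_add_two {s k : ℕ} (h : k < Nat.size s) :
    guessCost s (k + 1) + 2 = guessCost s k := by
  unfold guessCost
  omega

theorem guessCost_succ_of_size_le {s k : ℕ} (h : Nat.size s ≤ k) :
    guessCost s (k + 1) = guessCost s k + 2 := by
  unfold guessCost
  omega

variable {p : ℝ} {s : ℕ}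

theorem contention_drift_of_sparse (hp0 : 0 ≤ p) (hp1 : p ≤ 1) (hs : s * p ≤ 1 / 2) :
    silenceProb p s * (-2) + successProb p s * (-successGain) + collisionProb p s * 2 ≤ -1 := by
  have hsilence := one_sub_mul_le_silenceProb (s := s) hp1
  have hsuccess := mul_silenceProb_le_successProb (s := s) hp0 hp1
  have hhalf : s * p * (1 / 2) ≤ s * p * silenceProb p s := by
    gcongr
    linarith
  have hload : 0 ≤ s * p := by positivity
  rw [collisionProb, successGain]
  push_cast
  linarith

theorem contention_drift_of_fit (hp0 : 0 < p) (hp : p ≤ 1 / 2) (hs : 1 / 2 ≤ s * p)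
    (hs' : s * p ≤ 4) :
    silenceProb p s * 2 + successProb p s * (-successGain) + collisionProb p s * 2 ≤ -1 := by
  have hsuccess : 1 / 512 ≤ successProb p s :=
    calc (1 : ℝ) / 512 = 1 / 2 * (1 / 256) := by norm_num
      _ ≤ s * p * silenceProb p s := by
        gcongr
        exact one_div_le_silenceProb hp0 hp hs'
      _ ≤ successProb p s := mul_silenceProb_le_successProb hp0.le (by linarith)
  rw [collisionProb, successGain]
  push_cast
  linarith

theorem contention_drift_of_dense (hp0 : 0 ≤ p) (hp1 : p ≤ 1) (hs : 4 ≤ s * p) :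
    silenceProb p s * 2 + successProb p s * (-successGain) + collisionProb p s * (-2) ≤ -1 := by
  have hsuccess := successProb_nonneg (s := s) hp0 hp1
  have hsilence : silenceProb p s * 5 ≤ 1 :=
    calc silenceProb p s * 5 ≤ silenceProb p s * (1 + s * p) :=
          mul_le_mul_of_nonneg_left (by linarith) (silenceProb_nonneg hp1)
      _ ≤ 1 := silenceProb_mul_one_add_le_one hp0 hp1
  rw [collisionProb, successGain]
  push_cast
  linarith

theorem guessCost_sub_drift (s k : ℕ) :
    silenceProb (2 ^ (k + 1))⁻¹ s * (guessCost s k - guessCost s (k + 1)) +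
        successProb (2 ^ (k + 1))⁻¹ s * (-successGain) +
        collisionProb (2 ^ (k + 1))⁻¹ s * (guessCost s (k + 2) - guessCost s (k + 1)) ≤ -1 := by
  set p : ℝ := (2 ^ (k + 1))⁻¹ with hp
  have hp0 : 0 < p := by positivity
  have hp_half : p ≤ 1 / 2 := by
    rw [hp, one_div]
    exact inv_anti₀ two_pos (le_self_pow₀ one_le_two k.succ_ne_zero)
  have hp1 : p ≤ 1 := by linarith
  have hsp : s * p = s / 2 ^ (k + 1) := (div_eq_mul_inv _ _).symm
  rcases le_or_gt (Nat.size s) k with hsize | hsize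
  · have hs : s < 2 ^ k := Nat.size_le.mp hsize
    rw [guessCost_succ_of_size_le (hsize.trans k.le_succ), guessCost_succ_of_size_le hsize]
    have hsparse := contention_drift_of_sparse (s := s) hp0.le hp1 (by
      rw [hsp, div_le_div_iff₀ (by positivity) two_pos, one_mul, pow_succ]
      gcongr
      exact_mod_cast hs.le)
    push_cast
    linarith
  · have hs : 2 ^ k ≤ s := Nat.lt_size.mp hsize
    rw [← guessCost_succ_add_two hsize]
    rcases le_or_gt (s : ℝ) (4 * 2 ^ (k + 1)) with hs4 | hs4
    · have hfit := contention_drift_of_fit (s := s) hp0 hp_half (by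
        rw [hsp, div_le_div_iff₀ two_pos (by positivity), one_mul, pow_succ]
        gcongr
        exact_mod_cast hs) (by rwa [hsp, div_le_iff₀ (by positivity)])
      have hcost : (guessCost s (k + 2) : ℝ) ≤ guessCost s (k + 1) + 2 := by
        exact_mod_cast guessCost_succ_le s (k + 1)
      have := mul_le_mul_of_nonneg_left (sub_le_iff_le_add'.mpr hcost)
        (collisionProb_nonneg (s := s) hp0.le hp1)
      push_cast
      linarith
    · have hdense := contention_drift_of_dense (s := s) hp0.le hp1 (by
        rw [hsp, le_div_iff₀ (by positivity)]
        exact hs4.le)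
      have hsize' : k + 1 < Nat.size s := Nat.lt_size.mpr (by
        have : 4 * 2 ^ (k + 1) < s := by exact_mod_cast hs4
        omega)
      rw [← guessCost_succ_add_two hsize']
      push_cast
      linarith

theorem guessCost_drift (s k : ℕ) :
    silenceProb (2 ^ (k + 1))⁻¹ s * guessCost s k +
        successProb (2 ^ (k + 1))⁻¹ s * (guessCost s (k + 1) - successGain) +
        collisionProb (2 ^ (k + 1))⁻¹ s * guessCost s (k + 2) ≤
      guessCost s (k + 1) - 1 := by
  set p : ℝ := (2 ^ (k + 1))⁻¹
  have hsum : silenceProb p s + successProb p s + collisionProb p s = 1 := by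
    rw [collisionProb]; ring
  linear_combination guessCost_sub_drift s k + hsum * guessCost s (k + 1)

end Contention

section Halving

variable {α M : Type*} [LinearOrder M] (S : Finset α) (w : α → M)

theorem card_le_two_mul_card_filter_rank_lt :
    S.card ≤ 2 * (S.filter fun i => 2 * (S.filter fun j => w j < w i).card < S.card).card := by
  classical
  set low := S.filter fun i => 2 * (S.filter fun j => w j < w i).card < S.card
  have hpartition : low.card + (S \ low).card = S.card := by
    rw [add_comm]; exact Finset.card_sdiff_add_card_eq_card (Finset.filter_subset _ S)
  rcases (S \ low).eq_empty_or_nonempty with hhigh | hhigh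
  · rw [hhigh, Finset.card_empty] at hpartition
    omega
  · obtain ⟨i, hi, hmin⟩ := (S \ low).exists_min_image w hhigh
    obtain ⟨hiS, hilow⟩ := Finset.mem_sdiff.mp hi
    have hrank : (S.filter fun j => w j < w i).card ≤ low.card := by
      refine Finset.card_le_card fun j hj => ?_
      obtain ⟨hjS, hji⟩ := Finset.mem_filter.mp hj
      by_contra hjlow
      exact hji.not_ge (hmin j (Finset.mem_sdiff.mpr ⟨hjS, hjlow⟩))
    have : S.card ≤ 2 * (S.filter fun j => w j < w i).card :=
      not_lt.mp fun h => hilow (Finset.mem_filter.mpr ⟨hiS, h⟩)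
    omega

theorem size_lt_size_of_two_mul_lt {r c : ℕ} (h : 2 * r < c) : Nat.size r < Nat.size c := by
  rw [Nat.lt_size]
  cases hr : Nat.size r with
  | zero => omega
  | succ j =>
    have : 2 ^ j ≤ r := Nat.lt_size.mp (by omega)
    omega

theorem two_mul_sum_size_rank_add_card_le :
    2 * ∑ i ∈ S, Nat.size (S.filter fun j => w j < w i).card + S.card ≤
      2 * (S.card * Nat.size S.card) := by
  have hsize : ∀ i ∈ S, Nat.size (S.filter fun j => w j < w i).card +
      (if 2 * (S.filter fun j => w j < w i).card < S.card then 1 else 0) ≤ Nat.size S.card := by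
    intro i _
    split_ifs with hlow
    · exact size_lt_size_of_two_mul_lt hlow
    · exact Nat.size_le_size (Finset.card_le_card (Finset.filter_subset _ _))
  have hsum := Finset.sum_le_sum hsize
  rw [Finset.sum_add_distrib, ← Finset.card_filter, Finset.sum_const, smul_eq_mul] at hsum
  have := card_le_two_mul_card_filter_rank_lt S w
  omega

end Halving

/-! ## The algorithm and its correctness -/

section Definitions

variable {n : ℕ}

/-- The phases of the randomized search. In `search best` the stations look for an edge of smallest
weight among the edges that join different trees of the current forest; `best` is the lightest such
edge heard so far, with its weight. In `collect x` such edges of weight `x` are added to the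
forest. -/
inductive Phase (n : ℕ)
  | search (best : Option (Sym2 (Fin n) × ℝ))
  | collect (x : ℝ)
  | finished

/-- The weights of the edges that take part in a phase. -/
def Phase.Eligible : Phase n → ℝ → Prop
  | .search best, x => ∀ b ∈ best, x < b.2
  | .collect y, x => x = y
  | .finished, _ => False

/-- The state of the randomized search for the next edges of a minimum-weight spanning forest, apart
from the resolution of contention. -/
structure Search (n : ℕ) where
  forest : Finset (Sym2 (Fin n))
  phase : Phase n

/-- The edges, with their weights, whose stations take part in the current phase. -/
def Search.Eligible (s : Search n) (e : Sym2 (Fin n)) (x : ℝ) : Prop :=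
  e ∉ edgeSpan (s.forest : Set (Sym2 (Fin n))) ∧ s.phase.Eligible x

/-- The state of the search once no station takes part in the current phase. -/
def Search.advance (s : Search n) : Search n :=
  match s.phase with
  | .search none => ⟨s.forest, .finished⟩
  | .search (some b) => ⟨insert b.1 s.forest, .collect b.2⟩
  | .collect _ => ⟨s.forest, .search none⟩
  | .finished => s

/-- The state of the search after the edge `e` of weight `x` was heard. -/
def Search.hear (s : Search n) (e : Sym2 (Fin n)) (x : ℝ) : Search n :=
  match s.phase with
  | .search _ => ⟨s.forest, .search (some (e, x))⟩
  | .collect _ => ⟨insert e s.forest, s.phase⟩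
  | .finished => s

/-- The state of the randomized search with the resolution of contention: the stations that take
part in the current phase of `search` transmit with probability `2⁻ᵏ`, where `k` is `guess`. -/
structure Contention (n : ℕ) where
  search : Search n
  guess : ℕ

/-- The query of the randomized search. -/
noncomputable def Contention.query (c : Contention n) : Query n where
  specified _ e x := c.search.Eligible e x
  prob := (2 ^ c.guess)⁻¹
  prob_le_one := inv_le_one_of_one_le₀ (one_le_pow₀ one_le_two)
  content := .edgeAndWeight

/-- The reaction of the randomized search to the feedback. Silence proves that no station takes part
in the phase only at the transmission probability `1`. -/
def Contention.update (c : Contention n) : Feedback n → Contention n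
  | .silence =>
    match c.guess with
    | 0 => ⟨c.search.advance, 0⟩
    | k + 1 => ⟨c.search, k⟩
  | .collision => ⟨c.search, c.guess + 1⟩
  | .heard (.edgeAndWeight e x) => ⟨c.search.hear e x, c.guess⟩
  | .heard _ => c

/-- The state of the deterministic scan, in which the stations transmit one after the other in the
order of their IDs, until silence shows that there are no more stations. -/
structure Scan where
  count : ℕ
  finished : Bool

/-- The query of the scan. -/
def Scan.query (n : ℕ) (s : Scan) : Query n where
  specified p _ _ := p = s.count + 1
  prob := 1
  prob_le_one := le_rfl
  content := .edgeAndWeight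

/-- The reaction of the scan to the feedback. -/
def Scan.update (s : Scan) : Feedback n → Scan
  | .heard _ => ⟨s.count + 1, s.finished⟩
  | _ => ⟨s.count, true⟩

/-- The state of the algorithm, which alternates between the scan and the randomized search. -/
structure State (n : ℕ) where
  scanTurn : Bool
  scan : Scan
  contention : Contention n

/-- The initial state of the algorithm. -/
def State.init (n : ℕ) : State n := ⟨true, ⟨0, false⟩, ⟨⟨∅, .search none⟩, 0⟩⟩

/-- The reaction of the algorithm to the feedback. -/
def State.update (s : State n) (f : Feedback n) : State n :=
  match s.scanTurn with
  | true => ⟨false, s.scan.update f, s.contention⟩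
  | false => ⟨true, s.scan, s.contention.update f⟩

/-- The algorithm halts in the state `s`. -/
def State.Halted (s : State n) : Prop :=
  s.scan.finished = true ∨ s.contention.search.phase = .finished

/-- The state of the algorithm after the history `h`. -/
def stateAfter (h : History n) : State n := h.foldl State.update (State.init n)

theorem stateAfter_concat (h : History n) (f : Feedback n) :
    stateAfter (h ++ [f]) = (stateAfter h).update f := by
  simp [stateAfter]

/-- The graph formed by the edges that have been heard. -/
def History.heardGraph (h : History n) : SimpleGraph (Fin n) :=
  SimpleGraph.fromEdgeSet {e | h.Reveals e}

/-- The weights `w` agree with the ones that have been heard. -/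
def History.Consistent (h : History n) (w : Sym2 (Fin n) → ℝ) : Prop :=
  ∀ e x, Feedback.heard (.edgeAndWeight e x) ∈ h → w e = x

open Classical in
/-- The algorithm that alternates between the scan and the randomized search. It returns the forest
of the search if the search is finished, and otherwise a minimum-weight spanning forest of the graph
that has been heard. -/
noncomputable def forestAlgorithm : Algorithm where
  query n h :=
    if (stateAfter h).Halted then none
    else some (if (stateAfter h).scanTurn then (stateAfter h).scan.query n
      else (stateAfter h).contention.query)
  output _ h :=
    if (stateAfter h).contention.search.phase = .finished
    then (stateAfter h).contention.search.forest
    else Classical.epsilon fun F =>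
      ∃ w, h.Consistent w ∧ IsMinWeightSpanningForest h.heardGraph w F

theorem forestAlgorithm_running_iff {h : History n} :
    forestAlgorithm.Running h ↔ ¬ (stateAfter h).Halted := by
  simp [Algorithm.Running, forestAlgorithm]

end Definitions

section Input

variable {n m : ℕ} (inp : Input n m)

theorem Input.edge_mem (i : Fin m) : inp.edge i ∈ inp.graph.edgeSet := (inp.holds i).2

theorem Input.exists_edge_eq {e : Sym2 (Fin n)} (he : e ∈ inp.graph.edgeSet) :
    ∃ i, inp.edge i = e :=
  ⟨inp.holds.symm ⟨e, he⟩, by simp [Input.edge]⟩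

theorem Input.feedback_empty (c : Content) : inp.feedback c ∅ = .silence := by
  simp [Input.feedback]

theorem Input.feedback_singleton (c : Content) (i : Fin m) :
    inp.feedback c {i} = .heard (c.message (inp.edge i) (inp.weight (inp.edge i))) := by
  simp [Input.feedback]

theorem Input.feedback_of_two_le (c : Content) {A : Finset (Fin m)} (hA : 2 ≤ A.card) :
    inp.feedback c A = .collision := by
  rw [← Finset.length_toList] at hA
  unfold Input.feedback
  split <;> simp_all

theorem eq_empty_or_eq_singleton_or_two_le_card {α : Type*} (A : Finset α) :
    A = ∅ ∨ (∃ i, A = {i}) ∨ 2 ≤ A.card := by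
  rw [← Finset.card_eq_zero, ← Finset.card_eq_one]
  omega

theorem Input.exists_eq_message_of_feedback_eq_heard {c : Content} {A : Finset (Fin m)}
    {msg : Message n} (hA : inp.feedback c A = .heard msg) :
    ∃ i, msg = c.message (inp.edge i) (inp.weight (inp.edge i)) := by
  rcases eq_empty_or_eq_singleton_or_two_le_card A with rfl | ⟨i, rfl⟩ | h2
  · simp [inp.feedback_empty] at hA
  · rw [inp.feedback_singleton, Feedback.heard.injEq] at hA
    exact ⟨i, hA.symm⟩
  · simp [inp.feedback_of_two_le c h2] at hA

open Classical in
/-- The stations that take part in the current phase of the search. -/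
noncomputable def Input.active (s : Search n) : Finset (Fin m) :=
  Finset.univ.filter fun i => s.Eligible (inp.edge i) (inp.weight (inp.edge i))

theorem Input.mem_active {s : Search n} {i : Fin m} :
    i ∈ inp.active s ↔ s.Eligible (inp.edge i) (inp.weight (inp.edge i)) := by
  simp [Input.active]

theorem Input.card_active_le (s : Search n) : (inp.active s).card ≤ m := by
  simpa using Finset.card_le_univ (inp.active s)

theorem Input.not_eligible_of_active_eq_empty {s : Search n} (hs : inp.active s = ∅)
    {e : Sym2 (Fin n)} (he : e ∈ inp.graph.edgeSet) : ¬ s.Eligible e (inp.weight e) := by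
  obtain ⟨i, rfl⟩ := inp.exists_edge_eq he
  rw [← inp.mem_active, hs]
  exact Finset.notMem_empty i

theorem Input.specified_scan_of_lt {s : Scan} (h : s.count < m) :
    inp.specified (s.query n) = {⟨s.count, h⟩} := by
  ext i
  simp [Input.specified, Scan.query, Fin.ext_iff]

theorem Input.specified_scan_of_eq {s : Scan} (h : s.count = m) :
    inp.specified (s.query n) = ∅ := by
  ext i
  simp [Input.specified, Scan.query, h, i.2.ne]

end Input

section Steps

variable {n m : ℕ} {inp : Input n m} {h : History n}

theorem step_of_scanTurn (hh : ¬ (stateAfter h).Halted) (ht : (stateAfter h).scanTurn = true) :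
    forestAlgorithm.step inp h = PMF.pure
      (h ++ [inp.feedback .edgeAndWeight (inp.specified ((stateAfter h).scan.query n))]) := by
  have hq : forestAlgorithm.query n h = some ((stateAfter h).scan.query n) := by
    simp [forestAlgorithm, hh, ht]
  rw [Algorithm.step_of_query_eq_some hq]
  exact (congrArg _ (randomSubset_one _)).trans (PMF.pure_map _ _)

theorem step_of_not_scanTurn (hh : ¬ (stateAfter h).Halted)
    (ht : (stateAfter h).scanTurn = false) :
    forestAlgorithm.step inp h =
      (randomSubset (inp.active (stateAfter h).contention.search)
        (stateAfter h).contention.query.prob (stateAfter h).contention.query.prob_le_one).map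
          fun A => h ++ [inp.feedback .edgeAndWeight A] := by
  have hq : forestAlgorithm.query n h = some (stateAfter h).contention.query := by
    simp [forestAlgorithm, hh, ht]
  exact Algorithm.step_of_query_eq_some hq

theorem eq_active_of_mem_support_randomSubset {c : Contention n} {A : Finset (Fin m)}
    (hA : A ∈ (randomSubset (inp.active c.search) c.query.prob c.query.prob_le_one).support)
    (hc : c.guess = 0) : A = inp.active c.search := by
  have hp : c.query.prob = 1 := by simp [Contention.query, hc]
  simp only [hp, randomSubset_one] at hA
  exact (PMF.mem_support_pure_iff _ _).mp hA

theorem forall_mem_support_forestAlgorithm {I : History n → Prop} (hnil : I [])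
    (hscan : ∀ h, I h → ¬ (stateAfter h).Halted → (stateAfter h).scanTurn = true →
      I (h ++ [inp.feedback .edgeAndWeight (inp.specified ((stateAfter h).scan.query n))]))
    (hsearch : ∀ h, I h → (stateAfter h).scanTurn = false →
      ∀ A ⊆ inp.active (stateAfter h).contention.search,
        ((stateAfter h).contention.guess = 0 →
          A = inp.active (stateAfter h).contention.search) →
        I (h ++ [inp.feedback .edgeAndWeight A])) (t : ℕ) :
    ∀ h ∈ (forestAlgorithm.historyAt inp t).support, I h := by
  refine Algorithm.forall_mem_support_historyAt (I := fun _ => I) hnil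
    (fun _ h hI h' hh' => ?_) t
  by_cases hh : (stateAfter h).Halted
  · rw [Algorithm.step_of_not_running (forestAlgorithm_running_iff.not_left.mpr hh),
      PMF.mem_support_pure_iff] at hh'
    exact hh' ▸ hI
  cases ht : (stateAfter h).scanTurn
  · rw [step_of_not_scanTurn hh ht, PMF.mem_support_map_iff] at hh'
    obtain ⟨A, hA, rfl⟩ := hh'
    exact hsearch h hI ht A (subset_of_mem_support_randomSubset hA)
      (eq_active_of_mem_support_randomSubset hA)
  · rw [step_of_scanTurn hh ht, PMF.mem_support_pure_iff] at hh'
    exact hh' ▸ hscan h hI hh ht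

end Steps

section SearchInvariant

variable {n m : ℕ} {inp : Input n m} {h : History n} {F : Finset (Sym2 (Fin n))} {s : Search n}
  {c : Contention n}

/-- What is known in a phase of the search with the forest `F` after the history `h`. -/
def PhaseInvariant (inp : Input n m) (h : History n) (F : Finset (Sym2 (Fin n))) :
    Phase n → Prop
  | .search best =>
    (∀ e ∈ inp.graph.edgeSet, e ∉ edgeSpan (F : Set (Sym2 (Fin n))) →
      ∀ f ∈ F, inp.weight f < inp.weight e) ∧
    ∀ b ∈ best, b.1 ∈ inp.graph.edgeSet ∧ b.1 ∉ edgeSpan (F : Set (Sym2 (Fin n))) ∧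
      b.2 = inp.weight b.1 ∧ h.Reveals b.1
  | .collect x =>
    (∀ e ∈ inp.graph.edgeSet, e ∉ edgeSpan (F : Set (Sym2 (Fin n))) → x ≤ inp.weight e) ∧
    ∀ f ∈ F, inp.weight f ≤ x
  | .finished => inp.graph.edgeSet ⊆ edgeSpan (F : Set (Sym2 (Fin n)))

/-- The invariant of the randomized search: its forest is an initial part of a possible outcome of
Kruskal's algorithm. -/
structure SearchInvariant (inp : Input n m) (h : History n) (s : Search n) : Prop where
  greedy : IsGreedyForest inp.graph inp.weight s.forest
  revealed : ∀ e ∈ s.forest, h.Reveals e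
  phase : PhaseInvariant inp h s.forest s.phase

theorem History.Reveals.concat {e : Sym2 (Fin n)} (he : h.Reveals e) (f : Feedback n) :
    History.Reveals (h ++ [f]) e := by
  obtain ⟨msg, hmsg, hrev⟩ := he
  exact ⟨msg, List.mem_append_left _ hmsg, hrev⟩

theorem PhaseInvariant.concat {p : Phase n} (hp : PhaseInvariant inp h F p) (f : Feedback n) :
    PhaseInvariant inp (h ++ [f]) F p := by
  match p with
  | .search best =>
    refine ⟨hp.1, fun b hb => ?_⟩
    obtain ⟨hbG, hbF, hbw, hbh⟩ := hp.2 b hb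
    exact ⟨hbG, hbF, hbw, hbh.concat f⟩
  | .collect _ => exact hp
  | .finished => exact hp

theorem SearchInvariant.concat (hs : SearchInvariant inp h s) (f : Feedback n) :
    SearchInvariant inp (h ++ [f]) s :=
  ⟨hs.greedy, fun e he => (hs.revealed e he).concat f, hs.phase.concat f⟩

theorem notMem_edgeSpan_of_insert {e f : Sym2 (Fin n)}
    (he : e ∉ edgeSpan ((insert f F : Finset (Sym2 (Fin n))) : Set (Sym2 (Fin n)))) :
    e ∉ edgeSpan (F : Set (Sym2 (Fin n))) :=
  fun heF => he (edgeSpan_mono (Finset.coe_subset.mpr (Finset.subset_insert f F)) heF)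

theorem SearchInvariant.advance (hs : SearchInvariant inp h s) (hempty : inp.active s = ∅) :
    SearchInvariant inp h s.advance := by
  obtain ⟨F, p⟩ := s
  obtain ⟨hgreedy, hrev, hp⟩ := hs
  have hineligible : ∀ e ∈ inp.graph.edgeSet, e ∉ edgeSpan (F : Set (Sym2 (Fin n))) →
      ¬ p.Eligible (inp.weight e) := fun e he heF helig =>
    inp.not_eligible_of_active_eq_empty hempty he ⟨heF, helig⟩
  match p with
  | .search none =>
    exact ⟨hgreedy, hrev, fun e he =>
      by_contra fun heF => hineligible e he heF fun b hb => absurd hb (Option.not_mem_none b)⟩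
  | .search (some (b, x)) =>
    obtain ⟨hlt, hbest⟩ := hp
    obtain ⟨hbG, hbF, hx, hbh⟩ := hbest _ rfl
    obtain rfl : x = inp.weight b := hx
    have hmin : ∀ e ∈ inp.graph.edgeSet, e ∉ edgeSpan (F : Set (Sym2 (Fin n))) →
        inp.weight b ≤ inp.weight e := fun e he heF =>
      not_lt.mp fun hlt => hineligible e he heF (by simpa [Phase.Eligible] using hlt)
    exact ⟨hgreedy.insert_min hbG hbF hmin, Finset.forall_mem_insert .. |>.mpr ⟨hbh, hrev⟩,
      fun e he heF => hmin e he (notMem_edgeSpan_of_insert heF),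
      Finset.forall_mem_insert .. |>.mpr ⟨le_rfl, fun f hf => (hlt b hbG hbF f hf).le⟩⟩
  | .collect x =>
    obtain ⟨hmin, hle⟩ := hp
    refine ⟨hgreedy, hrev, fun e he heF f hf => ?_, by simp⟩
    exact (hle f hf).trans_lt ((hmin e he heF).lt_of_ne fun heq => hineligible e he heF heq.symm)
  | .finished => exact ⟨hgreedy, hrev, hp⟩

theorem SearchInvariant.hear (hs : SearchInvariant inp h s) {i : Fin m} (hi : i ∈ inp.active s)
    (hrev_i : h.Reveals (inp.edge i)) :
    SearchInvariant inp h (s.hear (inp.edge i) (inp.weight (inp.edge i))) := by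
  obtain ⟨F, p⟩ := s
  obtain ⟨hgreedy, hrev, hp⟩ := hs
  obtain ⟨hspan, helig⟩ := inp.mem_active.mp hi
  match p with
  | .search best =>
    refine ⟨hgreedy, hrev, hp.1, fun b hb => ?_⟩
    obtain rfl := Option.some.inj hb
    exact ⟨inp.edge_mem i, hspan, rfl, hrev_i⟩
  | .collect x =>
    obtain ⟨hmin, hle⟩ := hp
    obtain rfl : inp.weight (inp.edge i) = x := helig
    exact ⟨hgreedy.insert_min (inp.edge_mem i) hspan hmin,
      Finset.forall_mem_insert .. |>.mpr ⟨hrev_i, hrev⟩,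
      fun e he heF => hmin e he (notMem_edgeSpan_of_insert heF),
      Finset.forall_mem_insert .. |>.mpr ⟨le_rfl, hle⟩⟩
  | .finished => exact ⟨hgreedy, hrev, hp⟩

theorem SearchInvariant.update (hs : SearchInvariant inp h c.search) {A : Finset (Fin m)}
    (hA : A ⊆ inp.active c.search) (hguess : c.guess = 0 → A = inp.active c.search) :
    SearchInvariant inp (h ++ [inp.feedback .edgeAndWeight A])
      (c.update (inp.feedback .edgeAndWeight A)).search := by
  obtain ⟨s, k⟩ := c
  have hs' := hs.concat (inp.feedback .edgeAndWeight A)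
  rcases eq_empty_or_eq_singleton_or_two_le_card A with rfl | ⟨i, rfl⟩ | h2
  · rw [inp.feedback_empty] at hs' ⊢
    match k with
    | 0 => exact hs'.advance (hguess rfl).symm
    | _ + 1 => exact hs'
  · rw [inp.feedback_singleton] at hs' ⊢
    exact hs'.hear (Finset.singleton_subset_iff.mp hA)
      ⟨_, List.mem_append_right h (List.mem_singleton_self _), rfl⟩
  · rw [inp.feedback_of_two_le _ h2] at hs' ⊢
    exact hs'

end SearchInvariant

section Correctness

variable {n m : ℕ} {inp : Input n m} {h : History n} {s : Scan}

/-- The invariant of the scan: the first `count` stations have been heard. -/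
structure ScanInvariant (inp : Input n m) (h : History n) (s : Scan) : Prop where
  count_le : s.count ≤ m
  heard : ∀ i : Fin m, (i : ℕ) < s.count →
    .heard (.edgeAndWeight (inp.edge i) (inp.weight (inp.edge i))) ∈ h
  count_eq : s.finished = true → s.count = m

theorem ScanInvariant.concat (hs : ScanInvariant inp h s) (f : Feedback n) :
    ScanInvariant inp (h ++ [f]) s :=
  ⟨hs.count_le, fun i hi => List.mem_append_left _ (hs.heard i hi), hs.count_eq⟩

theorem ScanInvariant.update (hs : ScanInvariant inp h s) (hrun : s.finished = false) :
    ScanInvariant inp (h ++ [inp.feedback .edgeAndWeight (inp.specified (s.query n))])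
      (s.update (inp.feedback .edgeAndWeight (inp.specified (s.query n)))) := by
  have hs' := hs.concat (inp.feedback .edgeAndWeight (inp.specified (s.query n)))
  rcases hs.count_le.lt_or_eq with hlt | heq
  · rw [inp.specified_scan_of_lt hlt, inp.feedback_singleton] at hs' ⊢
    refine ⟨hlt, fun i hi => ?_, fun hfin => absurd hfin (by simp [Scan.update, hrun])⟩
    rcases Nat.lt_succ_iff_lt_or_eq.mp hi with hi | hi
    · exact hs'.heard i hi
    · obtain rfl : i = ⟨s.count, hlt⟩ := Fin.ext hi
      exact List.mem_append_right h (List.mem_singleton_self _)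
  · rw [inp.specified_scan_of_eq heq, inp.feedback_empty] at hs' ⊢
    exact ⟨hs'.count_le, hs'.heard, fun _ => heq⟩

theorem count_update_scan (hs : ScanInvariant inp h s)
    (hrun : (s.update (inp.feedback .edgeAndWeight (inp.specified (s.query n)))).finished =
      false) :
    (s.update (inp.feedback .edgeAndWeight (inp.specified (s.query n)))).count = s.count + 1 := by
  rcases hs.count_le.lt_or_eq with hlt | heq
  · rw [inp.specified_scan_of_lt hlt, inp.feedback_singleton]
    rfl
  · rw [inp.specified_scan_of_eq heq, inp.feedback_empty] at hrun
    simp [Scan.update] at hrun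

/-- The invariant of the algorithm. -/
structure Invariant (inp : Input n m) (h : History n) : Prop where
  heard_eq : ∀ msg, .heard msg ∈ h →
    ∃ i, msg = .edgeAndWeight (inp.edge i) (inp.weight (inp.edge i))
  scan : ScanInvariant inp h (stateAfter h).scan
  search : SearchInvariant inp h (stateAfter h).contention.search
  two_mul_count : (stateAfter h).scan.finished = false →
    2 * (stateAfter h).scan.count = h.length + if (stateAfter h).scanTurn then 0 else 1

theorem invariant_nil : Invariant inp [] where
  heard_eq := by simp
  scan := ⟨m.zero_le, fun i hi => absurd hi i.val.not_lt_zero, by simp [stateAfter, State.init]⟩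
  search := ⟨isGreedyForest_empty, by simp [stateAfter, State.init],
    fun _ _ _ f hf => absurd hf (Finset.notMem_empty f), by simp⟩
  two_mul_count := by simp [stateAfter, State.init]

theorem Invariant.heard_eq_concat (hI : Invariant inp h) (A : Finset (Fin m)) :
    ∀ msg, .heard msg ∈ h ++ [inp.feedback .edgeAndWeight A] →
      ∃ i, msg = .edgeAndWeight (inp.edge i) (inp.weight (inp.edge i)) := by
  intro msg hmsg
  rcases List.mem_append.mp hmsg with hmsg | hmsg
  · exact hI.heard_eq msg hmsg
  · exact inp.exists_eq_message_of_feedback_eq_heard (List.mem_singleton.mp hmsg).symm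

theorem Invariant.scan_step (hI : Invariant inp h) (hh : ¬ (stateAfter h).Halted)
    (ht : (stateAfter h).scanTurn = true) :
    Invariant inp (h ++
      [inp.feedback .edgeAndWeight (inp.specified ((stateAfter h).scan.query n))]) := by
  have hrun : (stateAfter h).scan.finished = false :=
    Bool.eq_false_iff.mpr fun hfin => hh (.inl hfin)
  refine ⟨hI.heard_eq_concat _, ?_, ?_, ?_⟩ <;> rw [stateAfter_concat, State.update, ht]
  · exact hI.scan.update hrun
  · exact hI.search.concat _
  · intro hrun'
    have hcount := hI.two_mul_count hrun
    simp only [ht, if_true, add_zero] at hcount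
    simp [count_update_scan hI.scan hrun', mul_add, hcount]

theorem Invariant.search_step (hI : Invariant inp h) (ht : (stateAfter h).scanTurn = false)
    {A : Finset (Fin m)} (hA : A ⊆ inp.active (stateAfter h).contention.search)
    (hguess : (stateAfter h).contention.guess = 0 →
      A = inp.active (stateAfter h).contention.search) :
    Invariant inp (h ++ [inp.feedback .edgeAndWeight A]) := by
  refine ⟨hI.heard_eq_concat _, ?_, ?_, ?_⟩ <;> rw [stateAfter_concat, State.update, ht]
  · exact hI.scan.concat _
  · exact hI.search.update hA hguess
  · intro hrun
    simpa [ht] using hI.two_mul_count hrun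

theorem invariant_of_mem_support (t : ℕ) :
    ∀ h ∈ (forestAlgorithm.historyAt inp t).support, Invariant inp h :=
  forall_mem_support_forestAlgorithm invariant_nil (fun _ hI => hI.scan_step)
    (fun _ hI ht _ => hI.search_step ht) t

theorem Invariant.consistent_weight (hI : Invariant inp h) : h.Consistent inp.weight := by
  intro e x hmem
  obtain ⟨i, hi⟩ := hI.heard_eq _ hmem
  obtain ⟨rfl, rfl⟩ := Message.edgeAndWeight.inj hi
  rfl

theorem Invariant.mem_heard_of_finished (hI : Invariant inp h)
    (hfin : (stateAfter h).scan.finished = true) {e : Sym2 (Fin n)} (he : e ∈ inp.graph.edgeSet) :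
    .heard (.edgeAndWeight e (inp.weight e)) ∈ h := by
  obtain ⟨i, rfl⟩ := inp.exists_edge_eq he
  exact hI.scan.heard i (i.2.trans_eq (hI.scan.count_eq hfin).symm)

theorem Invariant.heardGraph_eq_of_finished (hI : Invariant inp h)
    (hfin : (stateAfter h).scan.finished = true) : h.heardGraph = inp.graph := by
  rw [History.heardGraph, ← inp.graph.fromEdgeSet_edgeSet]
  congr 1
  ext e
  constructor
  · rintro ⟨msg, hmsg, hrev⟩
    obtain ⟨i, rfl⟩ := hI.heard_eq msg hmsg
    obtain rfl : inp.edge i = e := hrev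
    exact inp.edge_mem i
  · exact fun he => ⟨_, hI.mem_heard_of_finished hfin he, rfl⟩

theorem Invariant.output_of_scan_finished (hI : Invariant inp h)
    (hfin : (stateAfter h).scan.finished = true)
    (hsearch : (stateAfter h).contention.search.phase ≠ .finished) :
    IsMinWeightSpanningForest inp.graph inp.weight (forestAlgorithm.output n h) := by
  have hex : ∃ F w, h.Consistent w ∧ IsMinWeightSpanningForest h.heardGraph w F :=
    (exists_isMinWeightSpanningForest h.heardGraph inp.weight).imp fun F hF =>
      ⟨inp.weight, hI.consistent_weight, hF⟩
  obtain ⟨w, hw, hF⟩ : ∃ w, h.Consistent w ∧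
      IsMinWeightSpanningForest h.heardGraph w (forestAlgorithm.output n h) := by
    simp only [forestAlgorithm, hsearch, if_false]
    exact Classical.epsilon_spec hex
  rw [hI.heardGraph_eq_of_finished hfin] at hF
  exact hF.congr_weight fun e he => hw e _ (hI.mem_heard_of_finished hfin he)

theorem forestAlgorithm_findsMinWeightSpanningForest :
    forestAlgorithm.FindsMinWeightSpanningForest inp := by
  intro t h hh hhalt
  have hI := invariant_of_mem_support t h hh
  rw [forestAlgorithm_running_iff, not_not] at hhalt
  by_cases hsearch : (stateAfter h).contention.search.phase = .finished
  · have hspan := hI.search.phase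
    rw [hsearch] at hspan
    have hout : forestAlgorithm.output n h = (stateAfter h).contention.search.forest :=
      if_pos hsearch
    rw [hout]
    exact ⟨hI.search.greedy.isMinWeightSpanningForest hspan, hI.search.revealed⟩
  · have hfin := hhalt.resolve_right hsearch
    have hout := hI.output_of_scan_finished hfin hsearch
    exact ⟨hout, fun e he => ⟨_, hI.mem_heard_of_finished hfin (hout.1.1 e he), rfl⟩⟩

theorem forestAlgorithm_haltsWithin (hm : 1 ≤ m) : forestAlgorithm.HaltsWithin inp (3 * m) := by
  intro h hh hrun
  have hI := invariant_of_mem_support _ h hh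
  have hlength := Algorithm.length_eq_of_running hh hrun
  have hcount := hI.two_mul_count (Bool.eq_false_iff.mpr fun hfin =>
    forestAlgorithm_running_iff.mp hrun (.inl hfin))
  have := hI.scan.count_le
  omega

end Correctness

/-! ## Expected time of the algorithm -/

section Potential

variable {n m : ℕ} {inp : Input n m} {h : History n} {F T : Finset (Sym2 (Fin n))}
  {s : Search n} {c : Contention n}

/-- The part of the potential that accounts for the edges and for the weights of the
minimum-weight spanning forest `T` that the current forest `F` lacks: the first summand pays for
adding the edges, the second one for finding the next weight. -/
noncomputable def forestCost (inp : Input n m) (T F : Finset (Sym2 (Fin n))) : ℕ :=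
  successGain * (T.card - F.card) +
    ((2 * successGain + 8) * Nat.size m + 2) * (T.image inp.weight \ F.image inp.weight).card

/-- The part of the potential that does not depend on the transmission probability. A weight heard
in the phase `search` halves the number of active stations with probability at least `1 / 2`, hence
the factor `2 * successGain`. -/
noncomputable def remainingCost (inp : Input n m) (T : Finset (Sym2 (Fin n))) (s : Search n) : ℕ :=
  match s.phase with
  | .search _ =>
    forestCost inp T s.forest + 2 * successGain * Nat.size (inp.active s).card + 1
  | .collect _ => forestCost inp T s.forest + (2 * successGain + 4) * Nat.size m + 2
  | .finished => 0

/-- The potential of the randomized search, which bounds the expected number of its steps. -/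
noncomputable def potential (inp : Input n m) (T : Finset (Sym2 (Fin n))) (c : Contention n) : ℕ :=
  guessCost (inp.active c.search).card c.guess + remainingCost inp T c.search

theorem guessCost_active_zero_le (inp : Input n m) (s : Search n) :
    guessCost (inp.active s).card 0 ≤ 4 * Nat.size m := by
  rw [guessCost_zero_right]
  gcongr
  exact Nat.size_le_size (inp.card_active_le s)

theorem forestCost_insert_add_le {e : Sym2 (Fin n)} (he : e ∉ F)
    (hcard : (insert e F).card ≤ T.card) :
    forestCost inp T (insert e F) + successGain ≤ forestCost inp T F := by
  have hweights : (T.image inp.weight \ (insert e F).image inp.weight).card ≤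
      (T.image inp.weight \ F.image inp.weight).card := by
    gcongr
    exact Finset.subset_insert e F
  rw [Finset.card_insert_of_notMem he] at hcard
  rw [forestCost, forestCost, Finset.card_insert_of_notMem he, add_right_comm, ← mul_add_one]
  gcongr
  omega

theorem forestCost_insert_add_le_of_new_weight {e : Sym2 (Fin n)}
    (heT : inp.weight e ∈ T.image inp.weight) (heF : inp.weight e ∉ F.image inp.weight) :
    forestCost inp T (insert e F) + ((2 * successGain + 8) * Nat.size m + 2) ≤
      forestCost inp T F := by
  have hweights : (T.image inp.weight \ (insert e F).image inp.weight).card + 1 =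
      (T.image inp.weight \ F.image inp.weight).card := by
    rw [Finset.image_insert, Finset.sdiff_insert]
    exact Finset.card_erase_add_one (Finset.mem_sdiff.mpr ⟨heT, heF⟩)
  rw [forestCost, forestCost, ← hweights, mul_add_one, add_assoc]
  gcongr
  exact Finset.subset_insert e F

theorem potential_advance_lt (hT : IsMinWeightSpanningForest inp.graph inp.weight T)
    (hs : SearchInvariant inp h s) (hphase : s.phase ≠ .finished) (hempty : inp.active s = ∅) :
    potential inp T ⟨s.advance, 0⟩ < potential inp T ⟨s, 0⟩ := by
  have hguess := guessCost_active_zero_le inp s.advance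
  have hactive := Nat.size_le_size (inp.card_active_le s.advance)
  have hgreedy := (hs.advance hempty).greedy
  have hp := hs.phase
  obtain ⟨F, p⟩ := s
  match p with
  | .search none =>
    have hnone : inp.active (⟨F, .finished⟩ : Search n) = ∅ := by
      ext i
      simp [inp.mem_active, Search.Eligible, Phase.Eligible]
    simp [potential, remainingCost, Search.advance, hnone, guessCost]
  | .search (some (b, x)) =>
    obtain ⟨hlt, hbest⟩ := hp
    obtain ⟨hbG, hbF, -⟩ := hbest _ rfl
    have hcost := forestCost_insert_add_le_of_new_weight (inp := inp) (T := T) (F := F) (e := b)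
      (hgreedy.image_weight_subset hT
        (Finset.mem_image_of_mem inp.weight (Finset.mem_insert_self b F)))
      (by simpa using fun f hf => (hlt b hbG hbF f hf).ne)
    simp only [potential, remainingCost, Search.advance] at hguess ⊢
    linarith [Nat.zero_le (2 * successGain * Nat.size (inp.active ⟨F, .search (some (b, x))⟩).card),
      Nat.zero_le (guessCost (inp.active ⟨F, .search (some (b, x))⟩).card 0)]
  | .collect x =>
    simp only [potential, remainingCost, Search.advance] at hguess hactive ⊢
    have := Nat.mul_le_mul_left (2 * successGain) hactive
    linarith
  | .finished => exact absurd rfl hphase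

theorem active_hear_search_subset {best : Option (Sym2 (Fin n) × ℝ)} {i : Fin m}
    (hi : i ∈ inp.active ⟨F, .search best⟩) :
    inp.active (Search.hear ⟨F, .search best⟩ (inp.edge i) (inp.weight (inp.edge i))) ⊆
      (inp.active ⟨F, .search best⟩).filter
        fun j => inp.weight (inp.edge j) < inp.weight (inp.edge i) := by
  intro j hj
  obtain ⟨hjF, hji⟩ := inp.mem_active.mp hj
  have hji : inp.weight (inp.edge j) < inp.weight (inp.edge i) := hji _ rfl
  exact Finset.mem_filter.mpr
    ⟨inp.mem_active.mpr ⟨hjF, fun b hb => hji.trans ((inp.mem_active.mp hi).2 b hb)⟩, hji⟩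

theorem active_hear_subset {i : Fin m} (hi : i ∈ inp.active s) :
    inp.active (s.hear (inp.edge i) (inp.weight (inp.edge i))) ⊆ inp.active s := by
  obtain ⟨F, p⟩ := s
  match p with
  | .search best => exact (active_hear_search_subset hi).trans (Finset.filter_subset _ _)
  | .collect x =>
    intro j hj
    obtain ⟨hjF, hjx⟩ := inp.mem_active.mp hj
    exact inp.mem_active.mpr ⟨notMem_edgeSpan_of_insert hjF, hjx⟩
  | .finished => exact subset_rfl

theorem sum_remainingCost_hear_search_add_le (F T : Finset (Sym2 (Fin n)))
    (best : Option (Sym2 (Fin n) × ℝ)) :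
    ∑ i ∈ inp.active ⟨F, .search best⟩, remainingCost inp T
        (Search.hear ⟨F, .search best⟩ (inp.edge i) (inp.weight (inp.edge i))) +
        (inp.active ⟨F, .search best⟩).card * successGain ≤
      (inp.active ⟨F, .search best⟩).card * remainingCost inp T ⟨F, .search best⟩ := by
  set S := inp.active ⟨F, .search best⟩ with hS
  have hcost : ∀ i ∈ S, remainingCost inp T
      (Search.hear ⟨F, .search best⟩ (inp.edge i) (inp.weight (inp.edge i))) ≤
        forestCost inp T F + 1 + 2 * successGain * Nat.size (S.filter fun j =>
          inp.weight (inp.edge j) < inp.weight (inp.edge i)).card := by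
    intro i hi
    have := Nat.mul_le_mul_left (2 * successGain)
      (Nat.size_le_size (Finset.card_le_card (active_hear_search_subset hi)))
    simp only [remainingCost, Search.hear] at this ⊢
    linarith
  have hhalving := two_mul_sum_size_rank_add_card_le S fun i => inp.weight (inp.edge i)
  calc _ ≤ S.card * (forestCost inp T F + 1) + 2 * successGain * ∑ i ∈ S, Nat.size
          (S.filter fun j => inp.weight (inp.edge j) < inp.weight (inp.edge i)).card +
          S.card * successGain := by
        gcongr
        refine (Finset.sum_le_sum hcost).trans_eq ?_
        rw [Finset.sum_add_distrib, Finset.sum_const, smul_eq_mul, Finset.mul_sum]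
    _ ≤ S.card * (forestCost inp T F + 1) + successGain * (2 * (S.card * Nat.size S.card)) := by
        linarith [Nat.mul_le_mul_left successGain hhalving]
    _ = _ := by
        simp only [remainingCost, ← hS]
        ring

theorem sum_remainingCost_hear_add_le (hT : IsSpanningForest inp.graph T)
    (hs : SearchInvariant inp h s) (hphase : s.phase ≠ .finished) :
    ∑ i ∈ inp.active s, remainingCost inp T (s.hear (inp.edge i) (inp.weight (inp.edge i))) +
        (inp.active s).card * successGain ≤
      (inp.active s).card * remainingCost inp T s := by
  obtain ⟨F, p⟩ := s
  match p with
  | .search best => exact sum_remainingCost_hear_search_add_le F T best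
  | .collect x =>
    rw [← smul_eq_mul, ← smul_eq_mul, ← Finset.sum_const, ← Finset.sum_const,
      ← Finset.sum_add_distrib]
    refine Finset.sum_le_sum fun i hi => ?_
    obtain ⟨hspan, rfl⟩ := inp.mem_active.mp hi
    have hgreedy := hs.greedy.insert_min (inp.edge_mem i) hspan hs.phase.1
    have := forestCost_insert_add_le (inp := inp) (fun hF => hspan (subset_edgeSpan _ hF))
      (hgreedy.card_le hT)
    simp only [remainingCost, Search.hear]
    linarith
  | .finished => exact absurd rfl hphase

theorem sum_potential_hear_add_le (hT : IsSpanningForest inp.graph T)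
    (hs : SearchInvariant inp h s) (hphase : s.phase ≠ .finished) (k : ℕ) :
    ∑ i ∈ inp.active s, potential inp T ⟨s.hear (inp.edge i) (inp.weight (inp.edge i)), k⟩ +
        (inp.active s).card * successGain ≤
      (inp.active s).card * potential inp T ⟨s, k⟩ := by
  have hguess : ∑ i ∈ inp.active s,
      guessCost (inp.active (s.hear (inp.edge i) (inp.weight (inp.edge i)))).card k ≤
        (inp.active s).card * guessCost (inp.active s).card k :=
    Finset.sum_le_card_nsmul _ _ _ fun i hi =>
      guessCost_mono (Finset.card_le_card (active_hear_subset hi)) k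
  have hremaining := sum_remainingCost_hear_add_le hT hs hphase
  simp only [potential, Finset.sum_add_distrib, mul_add]
  linarith

theorem potential_update_active_lt (hT : IsMinWeightSpanningForest inp.graph inp.weight T)
    (hs : SearchInvariant inp h s) (hphase : s.phase ≠ .finished) :
    potential inp T ((⟨s, 0⟩ : Contention n).update
      (inp.feedback .edgeAndWeight (inp.active s))) < potential inp T ⟨s, 0⟩ := by
  rcases eq_empty_or_eq_singleton_or_two_le_card (inp.active s) with hempty | ⟨i, hi⟩ | h2
  · rw [hempty, inp.feedback_empty]
    exact potential_advance_lt hT hs hphase hempty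
  · have hhear := sum_potential_hear_add_le hT.1 hs hphase 0
    rw [hi, Finset.sum_singleton, Finset.card_singleton, one_mul, one_mul] at hhear
    rw [hi, inp.feedback_singleton]
    exact (Nat.lt_add_of_pos_right (by simp [successGain])).trans_le hhear
  · have hguess := guessCost_succ_add_two (Nat.size_pos.mpr (two_pos.trans_le h2))
    rw [inp.feedback_of_two_le _ h2]
    simp only [Contention.update, potential]
    linarith

theorem expectation_potential_update_succ_le (hT : IsSpanningForest inp.graph T)
    (hs : SearchInvariant inp h s) (hphase : s.phase ≠ .finished) (k : ℕ) {p : ℝ≥0} (hp : p ≤ 1)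
    (hpk : (p : ℝ) = (2 ^ (k + 1))⁻¹) :
    expectation (randomSubset (inp.active s) p hp) (fun A => (potential inp T
        ((⟨s, k + 1⟩ : Contention n).update (inp.feedback .edgeAndWeight A)) : ℝ≥0∞)) ≤
      ENNReal.ofReal (potential inp T ⟨s, k + 1⟩ - 1) := by
  set S := inp.active s
  set R := remainingCost inp T s
  have hempty : potential inp T ((⟨s, k + 1⟩ : Contention n).update
      (inp.feedback .edgeAndWeight ∅)) ≤ (guessCost S.card k + R : ℝ) := by
    rw [inp.feedback_empty]
    exact_mod_cast le_rfl
  have hsingleton : ∑ i ∈ S, (potential inp T ((⟨s, k + 1⟩ : Contention n).update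
      (inp.feedback .edgeAndWeight {i})) : ℝ) ≤
        S.card * (guessCost S.card (k + 1) + R - successGain) := by
    have hhear := sum_potential_hear_add_le hT hs hphase (k + 1)
    have hhear : (∑ i ∈ S, potential inp T ⟨s.hear (inp.edge i) (inp.weight (inp.edge i)), k + 1⟩
        : ℝ) + S.card * successGain ≤ S.card * (guessCost S.card (k + 1) + R) := by
      exact_mod_cast hhear
    simp only [inp.feedback_singleton]
    rw [mul_sub]
    exact le_sub_iff_add_le.mpr hhear
  have hlarge : ∀ A : Finset (Fin m), 2 ≤ A.card → potential inp T
      ((⟨s, k + 1⟩ : Contention n).update (inp.feedback .edgeAndWeight A)) ≤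
        (guessCost S.card (k + 2) + R : ℝ) := by
    intro A hA
    rw [inp.feedback_of_two_le _ hA]
    exact_mod_cast le_rfl
  refine (expectation_randomSubset_le (fun A => potential inp T ((⟨s, k + 1⟩ : Contention n).update
    (inp.feedback .edgeAndWeight A))) hempty hsingleton hlarge).trans (ENNReal.ofReal_le_ofReal ?_)
  have hdrift := guessCost_drift S.card k
  have hpotential : (potential inp T ⟨s, k + 1⟩ : ℝ) = guessCost S.card (k + 1) + R := by
    exact_mod_cast rfl
  rw [hpk, hpotential]
  simp only [collisionProb] at hdrift ⊢
  linarith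

theorem potential_drift (hT : IsMinWeightSpanningForest inp.graph inp.weight T)
    (hs : SearchInvariant inp h c.search) (hphase : c.search.phase ≠ .finished) :
    expectation (randomSubset (inp.active c.search) c.query.prob c.query.prob_le_one)
      (fun A => (potential inp T (c.update (inp.feedback .edgeAndWeight A)) : ℝ≥0∞)) + 1 ≤
        potential inp T c := by
  obtain ⟨s, k⟩ := c
  match k with
  | 0 =>
    have hp : (⟨s, 0⟩ : Contention n).query.prob = 1 := by simp [Contention.query]
    simp only [hp, randomSubset_one, expectation_pure]
    exact_mod_cast potential_update_active_lt hT hs hphase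
  | k + 1 =>
    have hpos : (1 : ℝ) ≤ potential inp T ⟨s, k + 1⟩ := by
      have : 1 ≤ potential inp T ⟨s, k + 1⟩ := by
        simp only [potential, guessCost]
        omega
      exact_mod_cast this
    calc _ ≤ ENNReal.ofReal (potential inp T ⟨s, k + 1⟩ - 1) + 1 := by
          gcongr
          exact expectation_potential_update_succ_le hT.1 hs hphase k _ (by simp [Contention.query])
      _ = potential inp T ⟨s, k + 1⟩ := by
          rw [← ENNReal.ofReal_one, ← ENNReal.ofReal_add (by linarith) zero_le_one,
            sub_add_cancel, ENNReal.ofReal_natCast]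

theorem forestAlgorithm_expectedTime_le
    (hT : IsMinWeightSpanningForest inp.graph inp.weight T) :
    forestAlgorithm.expectedTime inp ≤
      ((2 * potential inp T ⟨⟨∅, .search none⟩, 0⟩ + 1 : ℕ) : ℝ≥0∞) := by
  have hdrift := Algorithm.expectedTime_le_of_drift (alg := forestAlgorithm) (inp := inp)
    (Φ := fun h => 2 * (potential inp T (stateAfter h).contention : ℝ≥0∞) +
      if (stateAfter h).scanTurn then 1 else 0) fun t h hh hrun => ?_
  · simpa [stateAfter, State.init] using hdrift
  rw [forestAlgorithm_running_iff] at hrun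
  cases ht : (stateAfter h).scanTurn
  · have hsearch := potential_drift hT (invariant_of_mem_support t h hh).search
      fun hfin => hrun (.inr hfin)
    simp only [step_of_not_scanTurn hrun ht, expectation_map, stateAfter_concat, State.update, ht,
      Bool.false_eq_true, if_false, if_true, expectation_add, expectation_const_mul,
      expectation_const, add_zero]
    rw [add_assoc, one_add_one_eq_two, ← mul_add_one]
    gcongr
  · rw [step_of_scanTurn hrun ht, expectation_pure]
    simp [stateAfter_concat, State.update, ht]

theorem size_le_one_add_two_mul_log {m : ℕ} (hm : 1 ≤ m) :
    (Nat.size m : ℝ) ≤ 1 + 2 * Real.log m := by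
  obtain ⟨j, hj⟩ := Nat.exists_eq_add_of_le' (Nat.size_pos.mpr hm)
  have hpow : (2 : ℝ) ^ j ≤ m := by
    exact_mod_cast Nat.lt_size.mp (by omega)
  have hlog := Real.log_le_log (by positivity) hpow
  rw [Real.log_pow] at hlog
  rw [hj]
  push_cast
  nlinarith [Real.log_two_gt_d9, j.cast_nonneg (α := ℝ)]

theorem one_le_numWeights (hm : 1 ≤ m) (hT : IsSpanningForest inp.graph T) :
    1 ≤ numWeights inp.weight T :=
  Finset.card_pos.mpr ((hT.nonempty ⟨_, inp.edge_mem ⟨0, hm⟩⟩).image inp.weight)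

theorem potential_init_le (hm : 1 ≤ m) (hT : IsSpanningForest inp.graph T) :
    ((2 * potential inp T ⟨⟨∅, .search none⟩, 0⟩ + 1 : ℕ) : ℝ) ≤
      25000 * ((T.card : ℝ) + (numWeights inp.weight T : ℝ) * Real.log m) := by
  have hactive := Nat.size_le_size (inp.card_active_le ⟨∅, .search none⟩)
  have hguess := guessCost_active_zero_le inp ⟨∅, .search none⟩
  have hpotential : potential inp T ⟨⟨∅, .search none⟩, 0⟩ ≤ successGain * T.card +
      (2 * successGain + 4) * Nat.size m +
      ((2 * successGain + 8) * Nat.size m + 2) * numWeights inp.weight T + 1 := by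
    have := Nat.mul_le_mul_left (2 * successGain) hactive
    simp only [potential, remainingCost, forestCost, Finset.image_empty, Finset.sdiff_empty,
      Finset.card_empty, Nat.sub_zero]
    rw [numWeights]
    linarith
  have hpotential : (potential inp T ⟨⟨∅, .search none⟩, 0⟩ : ℝ) ≤ 1536 * T.card +
      3076 * Nat.size m + (3080 * Nat.size m + 2) * numWeights inp.weight T + 1 := by
    exact_mod_cast hpotential
  have hW : (numWeights inp.weight T : ℝ) ≤ T.card := by exact_mod_cast Finset.card_image_le
  have hW1 : (1 : ℝ) ≤ numWeights inp.weight T := by exact_mod_cast one_le_numWeights hm hT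
  have hsize : (Nat.size m : ℝ) ≤ Nat.size m * numWeights inp.weight T :=
    le_mul_of_one_le_right (Nat.cast_nonneg _) hW1
  have hsize_mul : (Nat.size m : ℝ) * numWeights inp.weight T ≤
      (1 + 2 * Real.log m) * numWeights inp.weight T := by
    gcongr
    exact size_le_one_add_two_mul_log hm
  have hlog : 0 ≤ numWeights inp.weight T * Real.log m :=
    mul_nonneg (Nat.cast_nonneg _) (Real.log_natCast_nonneg m)
  push_cast
  linarith

end Potential

end Channel

theorem mainTheorem4 :
    ∃ (alg : Channel.Algorithm) (C : ℝ) (K : ℕ),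
      ∀ (n m : ℕ), 1 ≤ m → ∀ inp : Channel.Input n m,
        alg.FindsMinWeightSpanningForest inp ∧
        (∀ T : Finset (Sym2 (Fin n)),
          IsMinWeightSpanningForest inp.graph inp.weight T →
          alg.expectedTime inp ≤
            ENNReal.ofReal (C * ((T.card : ℝ) + (numWeights inp.weight T : ℝ) * Real.log m))) ∧
        alg.HaltsWithin inp (K * m) := by
  refine ⟨Channel.forestAlgorithm, 25000, 3, fun n m hm inp =>
    ⟨Channel.forestAlgorithm_findsMinWeightSpanningForest, fun T hT => ?_,
      Channel.forestAlgorithm_haltsWithin hm⟩⟩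
  refine (Channel.forestAlgorithm_expectedTime_le hT).trans ?_
  rw [← ENNReal.ofReal_natCast]
  exact ENNReal.ofReal_le_ofReal (Channel.potential_init_le hm hT.1)
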